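/- **Theorem (complexity of supervised link prediction).** *Setting.* Let $G=(V,E)$ be a finite graph with contact frequencies, $V_e\subseteq V$ the set of egos, $E_e$ the set of links and $\overline E_e$ the set of missing links between egos, $\Gamma(i)$ the neighbourhood of $i$. For an ego $i$ the circle $\Gamma_{C_x}(i)\subseteq\Gamma(i)$ is computed by sorting $\Gamma(i)$ by contact frequency (merge sort), discarding the alters with less than one contact per year (binary search), clustering the remaining frequencies by one-dimensional mean shift with flat kernel, and keeping the $x$ innermost clusters. Supervised link prediction consists of the ego network computation (only in the circle-aware case), the extraction of the $d=4$ features common neighbours, Jaccard, Adamic–Adar and resource allocation for all links in $E_{train}=E_e\cup\overline E_e^{train}$, computed from the neighbourhoods $\Gamma(i)$ (baseline) or $\Gamma_{C_x}(i)$ (circle-aware) by hash-table intersection, and the training of a classifier on these features: logistic regression (gradient descent, fixed number of epochs), Gaussian naive Bayes, a decision tree, a random forest of $k\ge1$ trees (presorted features, depth at most a constant times $1+\log_2$ of the number of samples), or a kernel SVM (linear or polynomial kernel, sequential minimal optimization with at most a fixed number of passes over the $|E_{train}|$ samples). Here $\overline E_e^{train}\subseteq\overline E_e$; negatives are *undersampled*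 if $|\overline E_e^{train}|=|E_e|$, and the *full dataset* is used if $|\overline E_e^{train}|\ge\frac9{10}|\overline E_e|$. Time is the number of steps of a unit-cost random access machine with real arithmetic and hash tables; random choices are arbitrary. All constants may depend on the settings of the procedures (numbers of iterations, depth factor, kernel, …), which are fixed. The running time is the sum of the times of the three phases, and the extracted features are the four heuristics. Moreover: (a) *Table.* Let $\delta\ge1$ be a bound for the sizes $|\Gamma(i)|$ (baseline) or $|\Gamma_{C_x}(i)|$ (circle-aware) and $\Delta\ge2$ a bound for $|\Gamma(i)|$, over all $i\in V_e$. For training, on arbitrary features of any number $d\ge1$, assume $|E_e|\ge2$ in the undersampled and $|V_e|\ge 2$ in the full case. The times are | | undersampled | full dataset | |---|---|---| | logistic regression, naive Bayes | $O(|E_e|d)$ | $O(|V_e|^2d)$ | | decision tree | $O(|E_e|\log(|E_e|)\,d)$ | $O(|V_e|^2\log(|V_e|^2)\,d)$ | | random forest | $O(|E_e|\log(|E_e|)\,dk)$ | $O(|V_e|^2\log(|V_e|^2)\,dk)$ | | SVM (constant depending on $d$) | $O(|E_e|^2)$ | $O(|V_e|^4)$ | | feature extraction, baseline and circle-aware |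 $O(|E_e|\,\delta)$ | $O(|V_e|^2\,\delta)$ | | ego networks, baseline | $0$ | $0$ | | ego networks, circle-aware | $O(|V_e|\,\Delta\log\Delta)$ | $O(|V_e|\,\Delta\log\Delta)$ | (As $|V_e|\le|V|$, the bounds hold with $|V|$ in place of $|V_e|$.) (b) *Undersampled negatives; decision tree, random forest, SVM.* Training takes at least $c\,|E_e|\log|E_e|$ steps, with a constant $c>0$. It dominates: for all $\Delta,B$ and $\varepsilon>0$ there is an $N$ such that, if $|\Gamma(i)|\le\Delta$ for all egos, $|V_e|\le B|E_e|$ and $|E_e|\ge N$, then, for the baseline and for every circle, the ego network computation and the feature extraction together take at most $\varepsilon$ times the training time, and the ego network computation takes at most $\varepsilon$ times the total time. (c) *Undersampled negatives; logistic regression, naive Bayes.* If $|\Gamma(i)|\le\Delta$ for all egos, $|V_e|\le B|E_e|$ and $|E_e|\ge1$, the total time, baseline or circle-aware, is at most $C|E_e|$ with $C$ depending on $\Delta,B$. The multiplicative factor is slightly smaller for the baseline: for all $A,B$ there are $C,\Gamma_0$ such that, if $\Gamma\ge\Gamma_0$, $\Gamma\le|\Gamma(i)|\le A\Gamma$ for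 all egos, $|V_e|\le B|E_e|$, $|E_e|\le B|V_e|$ and $|E_e|\ge1$, then $T_{\text{baseline}}<T_{\text{circle}}\le C\log(\Gamma)\,T_{\text{baseline}}$ for the total times and every circle. (d) *Full dataset.* If $|\Gamma(i)|\le\Delta$ for all egos, the computation of the ego networks takes at most $C|V_e|$ steps and $|E_e|\le C|V_e|$, with $C$ depending on $\Delta$; so it takes at most $CB|E_e|$ steps if $|V_e|\le B|E_e|$. It is negligible: for every $\varepsilon>0$ there is an $N$, depending on $\Delta,\varepsilon$, such that for $|V_e|\ge N$ it takes at most $\varepsilon$ times the feature extraction time, and at most $\varepsilon$ times the total time. Circle-aware feature extraction never takes longer than baseline feature extraction; and if $|\Gamma_{C_x}(i)|<|\Gamma(i)|$ for all egos and $|V_e|\ge N$, it takes strictly less time even when the ego network computation is added to it. -/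

import Mathlib

open Finset

noncomputable section

/-! ### Step counting -/

/-- A value together with the number of elementary steps spent on computing it.  The machine is the
usual unit-cost random access machine with real registers: an arithmetic operation, an elementary
function (`exp`, `log`, a power), a comparison, a read or write of an array cell, and an insertion
or a look-up in a hash table are one step each. -/
structure Timed (α : Type) where
  val : α
  steps : ℕ

namespace Timed

instance : Monad Timed where
  pure a := ⟨a, 0⟩
  bind x f := ⟨(f x.val).val, x.steps + (f x.val).steps⟩

/-- The value `a` of a straight-line expression made of `k` elementary operations. -/
def ops {α : Type} (k : ℕ) (a : α) : Timed α := ⟨a, k⟩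

def tick (k : ℕ) : Timed Unit := ⟨(), k⟩

/-- Run `f i` for every index `i` and store the results in an array; every pass through the loop
costs one step in addition to the steps of its body. -/
def forAll {ι β : Type} [Fintype ι] (f : ι → Timed β) : Timed (ι → β) :=
  ⟨fun i => (f i).val, ∑ i, ((f i).steps + 1)⟩

/-- Accumulate the sum of the results of `f i`; every pass costs one step for the loop and one for
the addition, in addition to the steps of its body. -/
def sumAll {ι : Type} [Fintype ι] (f : ι → Timed ℝ) : Timed ℝ :=
  ⟨∑ i, (f i).val, ∑ i, ((f i).steps + 2)⟩

/-- Loop through a list and update a state; one step per pass in addition to the body. -/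
def foldList {α σ : Type} (body : σ → α → Timed σ) : σ → List α → Timed σ
  | s, [] => pure s
  | s, a :: l => do
      tick 1
      let s' ← body s a
      foldList body s' l

/-- Apply `f` to every entry of an array; one step per entry in addition to the steps of `f`. -/
def mapList {α β : Type} (f : α → Timed β) : List α → Timed (List β)
  | [] => pure []
  | a :: l => do
      let b ← f a
      let r ← mapList f l
      ops 1 (b :: r)

/-- Merging of two sorted arrays.  A comparison reads two keys and compares them (three steps), and
every entry that is written to the output costs one step. -/
def merge {α : Type} (le : α → α → Bool) : List α → List α → Timed (List α)
  | [], ys => ops ys.length ys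
  | x :: xs, [] => ops (x :: xs).length (x :: xs)
  | x :: xs, y :: ys => do
      let b ← ops 3 (le x y)
      if b then do
        let r ← merge le xs (y :: ys)
        ops 1 (x :: r)
      else do
        let r ← merge le (x :: xs) ys
        ops 1 (y :: r)
termination_by xs ys => xs.length + ys.length

/-- Merge sort: copy the two halves, sort them, merge them. -/
def mergeSort {α : Type} (le : α → α → Bool) (l : List α) : Timed (List α) :=
  if _h : l.length ≤ 1 then ops 1 l
  else do
    tick (l.length + 2)
    let a ← mergeSort le (l.take (l.length / 2))
    let b ← mergeSort le (l.drop (l.length / 2))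
    merge le a b
termination_by l.length
decreasing_by
  · simp only [List.length_take]; omega
  · simp only [List.length_drop]; omega

/-- Binary search in `[lo, hi)` for the first index at which the test `p` fails, where `p` succeeds
on an initial segment. -/
def binarySearch (p : ℕ → Timed Bool) (lo hi : ℕ) : Timed ℕ :=
  if _h : lo < hi then do
    tick 3
    let b ← p ((lo + hi) / 2)
    if b then binarySearch p ((lo + hi) / 2 + 1) hi
    else binarySearch p lo ((lo + hi) / 2)
  else ops 1 lo
termination_by hi - lo
decreasing_by
  · omega
  · omega

end Timed

open Timed

/-! ### Settings of the procedures -/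

/-- Kernels of the support vector machine. -/
inductive SvmKernel where
  | linear
  | polynomial (degree : ℕ) (scale offset : ℝ)

/-- The settings that stay fixed while the network varies: the bandwidth, the tolerance and the
maximal number of iterations of mean shift; the number of epochs and the learning rate of logistic
regression; the depth limit of the trees, which is at most logarithmic in the number of samples;
the kernel, the box constraint, the tolerance and the maximal number of passes of the support vector
machine. -/
structure Settings where
  bandwidth : ℝ
  shiftTol : ℝ
  shiftIters : ℕ
  epochs : ℕ
  rate : ℝ
  maxDepth : ℕ → ℕ
  depthFactor : ℕ
  maxDepth_le : ∀ n, maxDepth n ≤ depthFactor * (Nat.log 2 n + 1)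
  kernel : SvmKernel
  box : ℝ
  svmTol : ℝ
  passes : ℕ

/-! ### Link prediction tasks -/

/-- A social network `(V, E)` with contact frequencies (in contacts per year), the set `V_e` of its
egos, and a set of missing links between egos, stored as pairs `i < j`, that serve as the negative
training links. -/
structure LinkTask where
  V : Type
  [fintypeV : Fintype V]
  [linearOrderV : LinearOrder V]
  graph : SimpleGraph V
  [decAdj : DecidableRel graph.Adj]
  freq : V → V → ℝ
  egos : Finset V
  negatives : Finset (V × V)
  negatives_spec : ∀ p ∈ negatives,
    p.1 ∈ egos ∧ p.2 ∈ egos ∧ p.1 < p.2 ∧ ¬ graph.Adj p.1 p.2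

attribute [instance] LinkTask.fintypeV LinkTask.linearOrderV LinkTask.decAdj

/-- `all` is the baseline, which uses whole neighbourhoods; `circle x` uses the social circle
`C_x`. -/
inductive Slicing where
  | all
  | circle (x : ℕ)

/-- The similarity heuristics: common neighbours, Jaccard, Adamic-Adar, resource allocation. -/
inductive Heuristic where
  | CN
  | JC
  | AA
  | RA

/-- The `d = 4` features of a pair of egos. -/
def heuristics : Fin 4 → Heuristic := ![.CN, .JC, .AA, .RA]

namespace LinkTask

variable (P : LinkTask)

/-- The neighbourhood `Γ(i)`. -/
def nbhd (i : P.V) : Finset P.V := univ.filter (fun j => P.graph.Adj i j)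

/-- The set `E_e` of links between egos. -/
def egoLinks : Finset (P.V × P.V) :=
  (P.egos ×ˢ P.egos).filter (fun p => p.1 < p.2 ∧ P.graph.Adj p.1 p.2)

/-- The set of missing links between egos. -/
def missingLinks : Finset (P.V × P.V) :=
  (P.egos ×ˢ P.egos).filter (fun p => p.1 < p.2 ∧ ¬ P.graph.Adj p.1 p.2)

/-- The set `E_train` of training links. -/
def trainLinks : Finset (P.V × P.V) := P.egoLinks ∪ P.negatives

/-- The type of the training links. -/
abbrev Link : Type := {p : P.V × P.V // p ∈ P.trainLinks}

/-- The label of a training link. -/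
def label (p : P.Link) : Bool := decide (P.graph.Adj p.1.1 p.1.2)

/-- The negatives are undersampled to match the number of positives. -/
def Undersampled : Prop := P.negatives.card = P.egoLinks.card

/-- The negatives are not undersampled: at least nine tenths of the missing links (the rest may be
kept for testing), possibly all of them, are used for training. -/
def FullDataset : Prop := 9 * P.missingLinks.card ≤ 10 * P.negatives.card

/-- The similarity of `i` and `j` for the heuristic `h` on the sliced neighbourhoods `Γω`. -/
def similarity (h : Heuristic) (Γω : P.V → Finset P.V) (i j : P.V) : ℝ :=
  match h with
  | .CN => ((Γω i ∩ Γω j).card : ℝ)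
  | .JC => ((Γω i ∩ Γω j).card : ℝ) / ((Γω i ∪ Γω j).card : ℝ)
  | .AA => ∑ z ∈ Γω i ∩ Γω j, 1 / Real.log ((P.nbhd z).card : ℝ)
  | .RA => ∑ z ∈ Γω i ∩ Γω j, 1 / ((P.nbhd z).card : ℝ)

end LinkTask

/-! ### Ego networks -/

/-- The list of partial sums `acc, acc + w₀, acc + w₀ + w₁, …`. -/
def prefixSums : ℝ → List ℝ → Timed (List ℝ)
  | acc, [] => ops 1 [acc]
  | acc, a :: w => do
      let s ← ops 2 (acc + a)
      let r ← prefixSums s w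
      ops 1 (acc :: r)

/-- One mean shift step with a flat kernel on the decreasing array `w`: replace `c` by the mean of
the entries in `[c - b, c + b]`.  The window is found by binary search and its mean is read off the
partial sums `S`. -/
def shiftOnce (b : ℝ) (w S : List ℝ) (c : ℝ) : Timed ℝ := do
  let lo ← binarySearch (fun k => ops 3 (decide (c + b < w.getD k 0))) 0 w.length
  let hi ← binarySearch (fun k => ops 3 (decide (c - b ≤ w.getD k 0))) 0 w.length
  ops 6 (if hi ≤ lo then c else (S.getD hi 0 - S.getD lo 0) / ((hi : ℝ) - (lo : ℝ)))

/-- Mean shift iterations from `c`, until the position moves by at most `tol` or the maximal number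
of iterations is reached. -/
def shiftIter (b tol : ℝ) (w S : List ℝ) : ℕ → ℝ → Timed ℝ
  | 0, c => pure c
  | T + 1, c => do
      let c' ← shiftOnce b w S c
      let done ← ops 3 (decide (|c' - c| ≤ tol))
      if done then pure c' else shiftIter b tol w S T c'

/-- Numbering of the clusters: the label increases by one whenever two consecutive modes differ by
more than the bandwidth. -/
def labelModes (b : ℝ) : ℝ → ℕ → List ℝ → Timed (List ℕ)
  | _, _, [] => pure []
  | prev, lab, m :: ms => do
      let lab' ← ops 5 (if |prev - m| ≤ b then lab else lab + 1)
      let r ← labelModes b m lab' ms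
      ops 1 (lab' :: r)

/-- One-dimensional mean shift clustering of the decreasing array `w`; the clusters are numbered
`1, 2, …` in order of decreasing values. -/
def meanShift (cfg : Settings) (w : List ℝ) : Timed (List ℕ) := do
  let S ← prefixSums 0 w
  let modes ← mapList (fun c => shiftIter cfg.bandwidth cfg.shiftTol w S cfg.shiftIters c) w
  labelModes cfg.bandwidth (modes.headD 0) 1 modes

namespace LinkTask

variable (P : LinkTask)

/-- The computation of the ego network of `i` and of its slice `C_x`: sort the neighbours by
decreasing contact frequency, cut off those with less than one contact per year by binary search,
cluster the remaining frequencies, and store the alters in the `x` innermost clusters (found by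
binary search in the labels) in a hash table. -/
def egoNetwork (cfg : Settings) (x : ℕ) (i : P.V) : Timed (Finset P.V) := do
  let alters ← Timed.mergeSort (fun j k => decide (P.freq i k ≤ P.freq i j)) (P.nbhd i).toList
  let w ← mapList (fun j => ops 1 (P.freq i j)) alters
  let m ← binarySearch (fun k => ops 2 (decide (1 ≤ w.getD k 0))) 0 w.length
  let labels ← meanShift cfg (w.take m)
  let c ← binarySearch (fun k => ops 2 (decide (labels.getD k 0 ≤ x))) 0 labels.length
  ops c (alters.take c).toFinset

/-- The ego network phase: the sliced neighbourhoods of all egos.  The neighbourhoods that the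
baseline uses are part of the input, stored in hash tables. -/
def egoPhase (cfg : Settings) : Slicing → Timed (P.V → Finset P.V)
  | .all => pure P.nbhd
  | .circle x => do
      let r ← forAll (fun i : {i : P.V // i ∈ P.egos} => P.egoNetwork cfg x i.1)
      pure (fun i => if h : i ∈ P.egos then r ⟨i, h⟩ else ∅)

/-- The sliced neighbourhoods: `Γ(i)` for the baseline, `Γ_{C_x}(i)` for the circle `C_x`. -/
def sliced (cfg : Settings) (s : Slicing) : P.V → Finset P.V := (P.egoPhase cfg s).val

/-! ### Feature extraction -/

/-- Intersection of two hash tables: look up every element of the smaller one in the larger. -/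
def intersect (s t : Finset P.V) : Timed (List P.V) := do
  let small ← ops 3 (decide (s.card ≤ t.card))
  let scan : Finset P.V → Finset P.V → Timed (List P.V) := fun a b =>
    foldList (fun (acc : List P.V) z => do
      let found ← ops 1 (decide (z ∈ b))
      if found then ops 1 (z :: acc) else pure acc) [] a.toList
  if small then scan s t else scan t s

/-- The computation of a heuristic for a pair with sliced neighbourhoods `s` and `t`. -/
def heuristic (h : Heuristic) (s t : Finset P.V) : Timed ℝ := do
  let c ← P.intersect s t
  match h with
  | .CN => ops 1 (c.length : ℝ)
  | .JC => ops 6 ((c.length : ℝ) / ((s.card : ℝ) + (t.card : ℝ) - (c.length : ℝ)))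
  | .AA => foldList (fun (acc : ℝ) z =>
      ops 4 (acc + 1 / Real.log ((P.nbhd z).card : ℝ))) 0 c
  | .RA => foldList (fun (acc : ℝ) z => ops 3 (acc + 1 / ((P.nbhd z).card : ℝ))) 0 c

/-- The feature extraction phase: all four heuristics for every training link. -/
def featurePhase (Γω : P.V → Finset P.V) : Timed (P.Link → Fin 4 → ℝ) :=
  forAll (fun p : P.Link =>
    forAll (fun f : Fin 4 => P.heuristic (heuristics f) (Γω p.1.1) (Γω p.1.2)))

end LinkTask

/-! ### Learning algorithms -/

/-- Samples with `d` real features and a binary label. -/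
structure Samples (ι : Type) (d : ℕ) where
  x : ι → Fin d → ℝ
  y : ι → Bool

namespace Samples

variable {ι : Type} [Fintype ι] [DecidableEq ι] {d : ℕ}

/-- One epoch of batch gradient descent for the logistic loss; the state holds the weights and the
intercept. -/
def logisticEpoch (D : Samples ι d) (rate : ℝ) (θ : (Fin d → ℝ) × ℝ) :
    Timed ((Fin d → ℝ) × ℝ) := do
  let r ← forAll (fun i : ι => do
    let z ← sumAll (fun f : Fin d => ops 3 (θ.1 f * D.x i f))
    ops 8 (1 / (1 + Real.exp (-(z + θ.2))) - (if D.y i then 1 else 0)))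
  let w ← forAll (fun f : Fin d => do
    let g ← sumAll (fun i : ι => ops 3 (r i * D.x i f))
    ops 3 (θ.1 f - rate * g))
  let g ← sumAll (fun i : ι => ops 1 (r i))
  ops 2 (w, θ.2 - rate * g)

def logisticIter (D : Samples ι d) (rate : ℝ) :
    ℕ → (Fin d → ℝ) × ℝ → Timed ((Fin d → ℝ) × ℝ)
  | 0, θ => pure θ
  | T + 1, θ => do
      tick 1
      let θ' ← D.logisticEpoch rate θ
      D.logisticIter rate T θ'

/-- Logistic regression, trained by a fixed number of epochs of gradient descent.  This and the
following procedures return the decision function that the computed parameters define; a positive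
value means that a link is predicted. -/
def trainLogistic (D : Samples ι d) (cfg : Settings) : Timed ((Fin d → ℝ) → ℝ) := do
  let θ0 ← forAll (fun _ : Fin d => ops 1 (0 : ℝ))
  let θ ← D.logisticIter cfg.rate cfg.epochs (θ0, 0)
  pure (fun v => ∑ f, θ.1 f * v f + θ.2)

/-- Gaussian naive Bayes: the number of samples and the mean and variance of every feature, for
each of the two classes. -/
def trainNaiveBayes (D : Samples ι d) : Timed ((Fin d → ℝ) → ℝ) := do
  let stats ← forAll (fun c : Bool => do
    let n ← sumAll (fun i : ι => ops 2 (if D.y i = c then (1 : ℝ) else 0))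
    let mean ← forAll (fun f : Fin d => do
      let s ← sumAll (fun i : ι => ops 3 (if D.y i = c then D.x i f else 0))
      ops 1 (s / n))
    let var ← forAll (fun f : Fin d => do
      let s ← sumAll (fun i : ι => ops 5 (if D.y i = c then (D.x i f - mean f) ^ 2 else 0))
      ops 1 (s / n))
    pure (n, mean, var))
  let logPost : Bool → (Fin d → ℝ) → ℝ := fun c v =>
    Real.log (stats c).1 + ∑ f, (-(v f - (stats c).2.1 f) ^ 2 / (2 * (stats c).2.2 f)
      - Real.log ((stats c).2.2 f) / 2)
  pure (fun v => logPost true v - logPost false v)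

/-- Binary decision trees; a leaf carries its score. -/
inductive Tree (d : ℕ) where
  | leaf (score : ℝ)
  | node (f : Fin d) (thr : ℝ) (l r : Tree d)

def Tree.eval {d : ℕ} : Tree d → (Fin d → ℝ) → ℝ
  | .leaf s, _ => s
  | .node f thr l r, v => if v f ≤ thr then l.eval v else r.eval v

/-- Split an array stably according to whether `x i f ≤ thr`. -/
def splitList (D : Samples ι d) (f : Fin d) (thr : ℝ) : List ι → Timed (List ι × List ι)
  | [] => pure ([], [])
  | i :: l => do
      let r ← D.splitList f thr l
      ops 3 (if D.x i f ≤ thr then (i :: r.1, r.2) else (r.1, i :: r.2))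

/-- The quality of a split of `n` samples, `p` of them positive, into a left part with `nl` samples,
`pl` of them positive, and the rest: maximizing it minimizes the Gini impurity. -/
def splitQuality (n p nl pl : ℝ) : ℝ :=
  (pl ^ 2 + (nl - pl) ^ 2) / nl + ((p - pl) ^ 2 + ((n - nl) - (p - pl)) ^ 2) / (n - nl)

/-- State of the search for the best split: the number of samples passed so far and the number of
positive ones among them, the last feature value, and the best split found, with its quality,
feature and threshold. -/
structure SplitState (d : ℕ) where
  nl : ℝ
  pl : ℝ
  last : Option ℝ
  best : Option (ℝ × Fin d × ℝ)

/-- Scan the samples in the order of feature `f`, and compare the splits between consecutive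
distinct values with the best split found so far. -/
def scanFeature (D : Samples ι d) (n p : ℝ) (best : Option (ℝ × Fin d × ℝ)) (f : Fin d)
    (sorted : List ι) : Timed (Option (ℝ × Fin d × ℝ)) := do
  let s ← foldList (fun (s : SplitState d) i => do
    let v ← ops 1 (D.x i f)
    let best' ← match s.last with
      | none => ops 1 s.best
      | some u => do
          let new ← ops 2 (decide (u < v))
          if new then do
            let q ← ops 15 (splitQuality n p s.nl s.pl)
            match s.best with
            | none => ops 4 (some (q, f, (u + v) / 2))
            | some b => ops 5 (if b.1 < q then some (q, f, (u + v) / 2) else some b)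
          else pure s.best
    ops 6 (⟨s.nl + 1, s.pl + (if D.y i then 1 else 0), some v, best'⟩ : SplitState d))
    (⟨0, 0, none, best⟩ : SplitState d) sorted
  pure s.best

/-- Growing a tree.  `rows` lists the samples of the current node and `S f` lists them in the order
of feature `f`; `cand path` is the set of features that may be used for the split at the node with
the given path from the root.  Nodes that are pure, that cannot be split, or that have reached the
depth limit become leaves. -/
def growTree (D : Samples ι d) (cand : List Bool → Finset (Fin d)) :
    ℕ → List Bool → List ι → (Fin d → List ι) → Timed (Tree d)
  | depth, path, rows, S => do
      let np ← foldList (fun (np : ℝ × ℝ) i =>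
        ops 3 (np.1 + 1, np.2 + (if D.y i then 1 else 0))) (0, 0) rows
      let pure? ← ops 2 (decide (np.2 = 0 ∨ np.2 = np.1))
      if pure? then ops 4 (.leaf (if np.2 = 0 then -1 else 1))
      else
        match depth with
        | 0 => ops 4 (.leaf (2 * np.2 / np.1 - 1))
        | depth + 1 => do
            let best ← foldList (fun b f => D.scanFeature np.1 np.2 b f (S f)) none
              (cand path).toList
            match best with
            | none => ops 4 (.leaf (2 * np.2 / np.1 - 1))
            | some b => do
                let rows' ← D.splitList b.2.1 b.2.2 rows
                let S' ← forAll (fun f : Fin d => D.splitList b.2.1 b.2.2 (S f))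
                let l ← D.growTree cand depth (false :: path) rows'.1 (fun f => (S' f).1)
                let r ← D.growTree cand depth (true :: path) rows'.2 (fun f => (S' f).2)
                ops 1 (.node b.2.1 b.2.2 l r)

/-- Training of one tree: sort the samples once by every feature, then grow the tree. -/
def buildTree (D : Samples ι d) (cfg : Settings) (cand : List Bool → Finset (Fin d)) :
    Timed (Tree d) := do
  let S ← forAll (fun f : Fin d =>
    Timed.mergeSort (fun i j : ι => decide (D.x i f ≤ D.x j f)) (univ : Finset ι).toList)
  D.growTree cand (cfg.maxDepth (Fintype.card ι)) [] (univ : Finset ι).toList S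

def trainTree (D : Samples ι d) (cfg : Settings) : Timed ((Fin d → ℝ) → ℝ) := do
  let t ← D.buildTree cfg (fun _ => univ)
  pure t.eval

/-- Random forest with `k` trees.  The random choices are arguments: `boot t` is the bootstrap
sample of tree `t`, and `cand t path` is the set of features drawn at a node of tree `t`. -/
def trainForest (D : Samples ι d) (cfg : Settings) (k : ℕ) (boot : Fin k → ι → ι)
    (cand : Fin k → List Bool → Finset (Fin d)) : Timed ((Fin d → ℝ) → ℝ) := do
  let trees ← forAll (fun t : Fin k => do
    let x ← forAll (fun i : ι => forAll (fun f : Fin d => ops 2 (D.x (boot t i) f)))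
    let y ← forAll (fun i : ι => ops 2 (D.y (boot t i)))
    Samples.buildTree ⟨x, y⟩ cfg (cand t))
  pure (fun v => ∑ t, (trees t).eval v)

/-- Evaluation of a kernel; the values are kept, so that no call is repeated. -/
def kernelEval (ker : SvmKernel) (u v : Fin d → ℝ) : Timed ℝ := do
  let s ← sumAll (fun f : Fin d => ops 3 (u f * v f))
  match ker with
  | .linear => pure s
  | .polynomial p a c => ops 3 ((a * s + c) ^ p)

def sgn (D : Samples ι d) (i : ι) : ℝ := if D.y i then 1 else -1

/-- The multiplier `a i` can move in direction `sgn i`. -/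
def canGoUp (D : Samples ι d) (box : ℝ) (a : ι → ℝ) (i : ι) : Prop :=
  if D.y i then a i < box else 0 < a i

/-- The multiplier `a i` can move in direction `- sgn i`. -/
def canGoDown (D : Samples ι d) (box : ℝ) (a : ι → ℝ) (i : ι) : Prop :=
  if D.y i then 0 < a i else a i < box

open Classical in
/-- Sequential minimal optimization of the dual problem with kernel matrix `K`: `a` are the
multipliers and `F i = ∑ j, a j * sgn j * K i j - sgn i`.  Each iteration moves the maximally
violating pair as far as the box allows, and updates `F`. -/
def smo (D : Samples ι d) (box tol : ℝ) (K : ι × ι → ℝ) :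
    ℕ → (ι → ℝ) → (ι → ℝ) → Timed ((ι → ℝ) × (ι → ℝ))
  | 0, a, F => pure (a, F)
  | T + 1, a, F => do
      let up ← foldList (fun (o : Option ι) i =>
        ops 7 (if D.canGoUp box a i ∧ (∀ j ∈ o, F i < F j) then some i else o))
        none (univ : Finset ι).toList
      let down ← foldList (fun (o : Option ι) i =>
        ops 7 (if D.canGoDown box a i ∧ (∀ j ∈ o, F j < F i) then some i else o))
        none (univ : Finset ι).toList
      match up, down with
      | some i, some j => do
          let opt ← ops 4 (decide (F j - F i ≤ tol))
          if opt then pure (a, F)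
          else do
            let η ← ops 7 (K (i, i) + K (j, j) - 2 * K (i, j))
            let room ← ops 10 (min (if D.y i then box - a i else a i)
              (if D.y j then a j else box - a j))
            let t ← ops 6 (if 0 < η then min room ((F j - F i) / η) else room)
            let a' ← ops 8 (Function.update (Function.update a i (a i + D.sgn i * t))
              j (a j - D.sgn j * t))
            let F' ← forAll (fun l : ι => ops 7 (F l + t * (K (l, i) - K (l, j))))
            D.smo box tol K T a' F'
      | _, _ => pure (a, F)

/-- Support vector machine: compute the kernel matrix, then run sequential minimal optimization for
at most a fixed number of passes, where a pass has as many iterations as there are samples. -/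
def trainSvm (D : Samples ι d) (cfg : Settings) : Timed ((Fin d → ℝ) → ℝ) := do
  let K ← forAll (fun p : ι × ι => kernelEval cfg.kernel (D.x p.1) (D.x p.2))
  let a0 ← forAll (fun _ : ι => ops 1 (0 : ℝ))
  let F0 ← forAll (fun i : ι => ops 2 (-D.sgn i))
  let r ← D.smo cfg.box cfg.svmTol K (cfg.passes * Fintype.card ι) a0 F0
  let free ← sumAll (fun i : ι => ops 5 (if 0 < r.1 i ∧ r.1 i < cfg.box then (1 : ℝ) else 0))
  let total ← sumAll (fun i : ι => ops 6 (if 0 < r.1 i ∧ r.1 i < cfg.box then r.2 i else 0))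
  let b ← ops 2 (-(total / free))
  pure (fun v => ∑ i, r.1 i * D.sgn i * (kernelEval cfg.kernel (D.x i) v).val + b)

end Samples

/-- The supervised learning algorithms.  A random forest has `k ≥ 1` trees and comes with its random
choices. -/
inductive Learner (ι : Type) (d : ℕ) where
  | logistic
  | naiveBayes
  | decisionTree
  | randomForest (k : ℕ) (hk : 1 ≤ k) (boot : Fin k → ι → ι)
      (cand : Fin k → List Bool → Finset (Fin d))
  | svm

namespace Learner

variable {ι : Type} {d : ℕ}

def train [Fintype ι] [DecidableEq ι] (cfg : Settings) (D : Samples ι d) :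
    Learner ι d → Timed ((Fin d → ℝ) → ℝ)
  | .logistic => D.trainLogistic cfg
  | .naiveBayes => D.trainNaiveBayes
  | .decisionTree => D.trainTree cfg
  | .randomForest k _ boot cand => D.trainForest cfg k boot cand
  | .svm => D.trainSvm cfg

/-- Logistic regression or naive Bayes. -/
def IsLogisticOrBayes : Learner ι d → Prop
  | .logistic => True
  | .naiveBayes => True
  | _ => False

end Learner

/-! ### Supervised link prediction and its running times -/

namespace LinkTask

variable (P : LinkTask)

/-- Training on arbitrary features `X` of the training links. -/
def trainPhase {d : ℕ} (cfg : Settings) (L : Learner P.Link d) (X : P.Link → Fin d → ℝ) :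
    Timed ((Fin d → ℝ) → ℝ) :=
  L.train cfg ⟨X, P.label⟩

/-- Supervised link prediction: ego networks, feature extraction, training. -/
def linkPrediction (cfg : Settings) (s : Slicing) (L : Learner P.Link 4) :
    Timed ((Fin 4 → ℝ) → ℝ) := do
  let Γω ← P.egoPhase cfg s
  let X ← P.featurePhase Γω
  P.trainPhase cfg L X

/-- Running time of supervised link prediction. -/
def totalSteps (cfg : Settings) (s : Slicing) (L : Learner P.Link 4) : ℝ :=
  ((P.linkPrediction cfg s L).steps : ℝ)

/-- Running time of the ego network computation within supervised link prediction. -/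
def egoSteps (cfg : Settings) (s : Slicing) : ℝ := ((P.egoPhase cfg s).steps : ℝ)

/-- Running time of the feature extraction within supervised link prediction. -/
def featureSteps (cfg : Settings) (s : Slicing) : ℝ :=
  ((P.featurePhase (P.sliced cfg s)).steps : ℝ)

/-- Running time of the training within supervised link prediction. -/
def trainSteps (cfg : Settings) (s : Slicing) (L : Learner P.Link 4) : ℝ :=
  ((P.trainPhase cfg L (P.featurePhase (P.sliced cfg s)).val).steps : ℝ)

/-- Running time of training on given features with any number `d` of features. -/
def trainStepsOn {d : ℕ} (cfg : Settings) (L : Learner P.Link d) (X : P.Link → Fin d → ℝ) : ℝ :=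
  ((P.trainPhase cfg L X).steps : ℝ)

/-- The number `|V_e|` of egos. -/
def nEgos : ℝ := (P.egos.card : ℝ)

/-- The number `|E_e|` of links between egos. -/
def nLinks : ℝ := (P.egoLinks.card : ℝ)

/-- All sliced neighbourhoods of egos have at most `δ` elements. -/
def SizeLE (cfg : Settings) (s : Slicing) (δ : ℝ) : Prop :=
  ∀ i ∈ P.egos, ((P.sliced cfg s i).card : ℝ) ≤ δ

end LinkTask

end

/-! The step counts satisfy explicit recurrences; the theorem compares their solutions.

Merge sort copies and merges linearly much at each of logarithmically many levels. The copying
occurs whatever the order of the input, so the time is also at least `n * log₂ n`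
(`mergeSort_steps_le`, `le_mergeSort_steps`). This gives the cost `Δ log Δ` of an ego network, where
mean shift contributes a fixed number of binary searches per alter, and the lower bound for trees
and forests, which presort. For the SVM the `n²` kernel evaluations suffice. In growing a tree, the
two children of a node share out its lists, so each level costs linear time and the depth limit
contributes a logarithm (`growTree_steps_le`).

Feature extraction has an exact cost: a sum over training links of an increasing function of the
smaller neighbourhood and of the intersection (`featurePhase_steps`). Hence shrinking the
neighbourhoods never costs time, and saves time on every link if all of them shrink strictly.

The comparisons follow. With undersampling and bounded degree, ego networks and features are linear
in `|E_e|`, while trees, forests and SVM need at least `|E_e| log |E_e|`. The step counts of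
logistic regression and naive Bayes do not depend on the feature values (`trainStepsOn_congr`), so
training cancels between baseline and circle; sorting, of order `|V_e| Γ log Γ`, then outweighs all
baseline feature extraction, of order `|E_e| Γ`, once `log Γ` is large. On the full dataset there
are quadratically many training links in `|V_e|` (`FullDataset.le_card_trainLinks`), against a
linear cost of the ego networks. -/

namespace Timed

/-! ### Step counts of sequencing and of indexed loops. -/

section Basic
variable {α β : Type}

@[simp] theorem pure_val (a : α) : (pure a : Timed α).val = a := rfl
@[simp] theorem pure_steps (a : α) : (pure a : Timed α).steps = 0 := rfl
@[simp] theorem bind_val (x : Timed α) (f : α → Timed β) : (x >>= f).val = (f x.val).val := rfl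
@[simp] theorem bind_steps (x : Timed α) (f : α → Timed β) :
    (x >>= f).steps = x.steps + (f x.val).steps := rfl
@[simp] theorem ops_val (k : ℕ) (a : α) : (ops k a).val = a := rfl
@[simp] theorem ops_steps (k : ℕ) (a : α) : (ops k a).steps = k := rfl
@[simp] theorem tick_steps (k : ℕ) : (tick k).steps = k := rfl
@[simp] theorem forAll_val {ι : Type} [Fintype ι] (f : ι → Timed β) (i : ι) :
    (forAll f).val i = (f i).val := rfl
@[simp] theorem forAll_steps {ι : Type} [Fintype ι] (f : ι → Timed β) :
    (forAll f).steps = ∑ i, ((f i).steps + 1) := rfl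
@[simp] theorem sumAll_steps {ι : Type} [Fintype ι] (f : ι → Timed ℝ) :
    (sumAll f).steps = ∑ i, ((f i).steps + 2) := rfl

theorem forAll_steps_le {ι : Type} [Fintype ι] (f : ι → Timed β) (k : ℕ)
    (h : ∀ i, (f i).steps ≤ k) : (forAll f).steps ≤ Fintype.card ι * (k + 1) := by
  rw [forAll_steps]
  refine (Finset.sum_le_card_nsmul _ _ (k + 1) fun i _ => by have := h i; omega).trans ?_
  simp

end Basic

/-! ### List loops, merge sort and binary search. -/

section Lists
variable {α β σ : Type}

theorem foldList_val (body : σ → α → Timed σ) (l : List α) (s : σ) :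
    (foldList body s l).val = l.foldl (fun s a => (body s a).val) s := by
  induction l generalizing s with
  | nil => simp [foldList]
  | cons a l ih => simp [foldList, ih]

theorem foldList_steps_le (body : σ → α → Timed σ) (k : ℕ) (h : ∀ s a, (body s a).steps ≤ k)
    (l : List α) (s : σ) : (foldList body s l).steps ≤ (k + 1) * l.length := by
  induction l generalizing s with
  | nil => simp [foldList]
  | cons a l ih =>
    have h1 := h s a
    have h2 := ih (body s a).val
    simp only [foldList, bind_steps, tick_steps, List.length_cons]
    nlinarith

theorem foldList_steps_le_sum (body : σ → α → Timed σ) (k : α → ℕ)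
    (h : ∀ s a, (body s a).steps ≤ k a) (l : List α) (s : σ) :
    (foldList body s l).steps ≤ (l.map fun a => k a + 1).sum := by
  induction l generalizing s with
  | nil => simp [foldList]
  | cons a l ih =>
    have h1 := h s a
    have h2 := ih (body s a).val
    simp only [foldList, bind_steps, tick_steps, List.map_cons, List.sum_cons]
    omega

/-- Feature extraction needs equality rather than a bound, because its times for two slicings are
compared with each other. -/
theorem foldList_steps_eq_sum (body : σ → α → Timed σ) (k : α → ℕ)
    (h : ∀ s a, (body s a).steps = k a) (l : List α) (s : σ) :
    (foldList body s l).steps = (l.map fun a => k a + 1).sum := by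
  induction l generalizing s with
  | nil => simp [foldList]
  | cons a l ih =>
    have h1 := h s a
    have h2 := ih (body s a).val
    simp only [foldList, bind_steps, tick_steps, List.map_cons, List.sum_cons]
    omega

theorem mapList_val (f : α → Timed β) (l : List α) :
    (mapList f l).val = l.map fun a => (f a).val := by
  induction l with
  | nil => simp [mapList]
  | cons a l ih => simp [mapList, ih]

theorem mapList_steps_le (f : α → Timed β) (k : ℕ) (h : ∀ a, (f a).steps ≤ k) (l : List α) :
    (mapList f l).steps ≤ (k + 1) * l.length := by
  induction l with
  | nil => simp [mapList]
  | cons a l ih =>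
    have h1 := h a
    simp only [mapList, bind_steps, ops_steps, List.length_cons]
    nlinarith

theorem merge_perm (le : α → α → Bool) (xs ys : List α) :
    (merge le xs ys).val.Perm (xs ++ ys) := by
  fun_induction merge le xs ys with
  | case1 ys => simp
  | case2 x xs => simp
  | case3 x xs y ys ih1 ih2 =>
    simp only [bind_val, ops_val]
    by_cases h : le x y = true
    · simpa [h] using ih1
    · simp only [h, Bool.false_eq_true, if_false, bind_val, ops_val]
      exact (ih2.cons y).trans (List.perm_middle.symm)

theorem merge_steps_le (le : α → α → Bool) (xs ys : List α) :
    (merge le xs ys).steps ≤ 4 * (xs.length + ys.length) := by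
  fun_induction merge le xs ys with
  | case1 ys => simp; omega
  | case2 x xs => simp
  | case3 x xs y ys ih1 ih2 =>
    simp only [bind_steps, ops_val, ops_steps]
    by_cases h : le x y = true
    · simp only [h, if_true, bind_steps, ops_steps]
      simp only [List.length_cons] at ih1 ⊢
      omega
    · simp only [h, Bool.false_eq_true, if_false, bind_steps, ops_steps]
      simp only [List.length_cons] at ih2 ⊢
      omega

theorem mergeSort_perm (le : α → α → Bool) (l : List α) : (mergeSort le l).val.Perm l := by
  fun_induction mergeSort le l with
  | case1 l h => simp
  | case2 l h ih1 ih2 =>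
    simp only [bind_val]
    refine (merge_perm _ _ _).trans ((ih1.append ih2).trans ?_)
    rw [List.take_append_drop]

/-- One level costs `n + 2` for copying and at most `4 * n` for merging; with the `+ 1` of each
recursive call this is `5 * n + 4`, at most `7 * n + 1` for `n ≥ 2`. -/
theorem mergeSort_steps_le (le : α → α → Bool) (l : List α) :
    (mergeSort le l).steps ≤ 7 * (l.length * Nat.clog 2 l.length) + 1 := by
  fun_induction mergeSort le l with
  | case1 l h => simp
  | case2 l h ih1 ih2 =>
    have hm := merge_steps_le le (mergeSort le (l.take (l.length / 2))).val
      (mergeSort le (l.drop (l.length / 2))).val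
    rw [(mergeSort_perm le _).length_eq, (mergeSort_perm le _).length_eq] at hm
    simp only [bind_steps, tick_steps]
    simp only [List.length_take, List.length_drop] at ih1 ih2 hm
    set n := l.length with hn
    -- The larger half has `(n + 1) / 2` entries, and rounding up lowers `clog` by exactly one, so
    -- both recursive calls are covered by `L`.
    have hc : Nat.clog 2 n = Nat.clog 2 ((n + 1) / 2) + 1 := by
      rw [Nat.clog_of_two_le (by norm_num) (by omega)]
      rfl
    set L := Nat.clog 2 ((n + 1) / 2)
    have h1 : Nat.clog 2 (min (n / 2) n) ≤ L := Nat.clog_mono_right _ (by omega)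
    have h2 : Nat.clog 2 (n - n / 2) ≤ L := Nat.clog_mono_right _ (by omega)
    have h3 := Nat.mul_le_mul_left (min (n / 2) n) h1
    have h4 := Nat.mul_le_mul_left (n - n / 2) h2
    have h5 : min (n / 2) n * L + (n - n / 2) * L = n * L := by
      rw [← Nat.add_mul]; congr 1; omega
    rw [hc, Nat.mul_add, Nat.mul_one]
    have h6 : min (n / 2) n + (n - n / 2) = n := by omega
    omega

/-- Copying the halves alone costs `n` per level, for every input order; the floor logarithm drops
by one when passing to the smaller half `n / 2`. -/
theorem le_mergeSort_steps (le : α → α → Bool) (l : List α) :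
    l.length * Nat.log 2 l.length ≤ (mergeSort le l).steps := by
  fun_induction mergeSort le l with
  | case1 l h =>
    have : Nat.log 2 l.length = 0 := Nat.log_of_lt (by omega)
    simp [this]
  | case2 l h ih1 ih2 =>
    simp only [bind_steps, tick_steps]
    simp only [List.length_take, List.length_drop] at ih1 ih2
    set n := l.length with hn
    have hc : Nat.log 2 n = Nat.log 2 (n / 2) + 1 := by
      rw [Nat.log_of_one_lt_of_le (by norm_num) (by omega)]
    set L := Nat.log 2 (n / 2)
    have h1 : L ≤ Nat.log 2 (min (n / 2) n) := Nat.log_mono_right (by omega)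
    have h2 : L ≤ Nat.log 2 (n - n / 2) := Nat.log_mono_right (by omega)
    have h3 := Nat.mul_le_mul_left (min (n / 2) n) h1
    have h4 := Nat.mul_le_mul_left (n - n / 2) h2
    have h5 : min (n / 2) n * L + (n - n / 2) * L = n * L := by
      rw [← Nat.add_mul]; congr 1; omega
    rw [hc, Nat.mul_add, Nat.mul_one]
    omega

/-- Holds for any test, monotone or not. It bounds the number of alters stored at the end of
`egoNetwork`, which enters its step count. -/
theorem binarySearch_val_le (p : ℕ → Timed Bool) (lo hi : ℕ) (h : lo ≤ hi) :
    (binarySearch p lo hi).val ≤ hi := by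
  fun_induction binarySearch p lo hi with
  | case1 lo hi hlt ih1 ih2 =>
    simp only [bind_val]
    split
    · exact ih1 (by omega)
    · exact (ih2 (by omega)).trans (by omega)
  | case2 lo hi hlt => simpa using h

theorem binarySearch_steps_le (p : ℕ → Timed Bool) (k : ℕ) (hp : ∀ i, (p i).steps ≤ k)
    (lo hi : ℕ) :
    (binarySearch p lo hi).steps ≤ (k + 3) * (Nat.log 2 (hi - lo) + 1) + 1 := by
  fun_induction binarySearch p lo hi with
  | case1 lo hi hlt ih1 ih2 =>
    simp only [bind_steps, tick_steps]
    have hk := hp ((lo + hi) / 2)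
    have key : ∀ lo' hi', hi' - lo' ≤ (hi - lo) / 2 →
        (binarySearch p lo' hi').steps ≤ (k + 3) * (Nat.log 2 (hi' - lo') + 1) + 1 →
        3 + ((p ((lo + hi) / 2)).steps + (binarySearch p lo' hi').steps) ≤
          (k + 3) * (Nat.log 2 (hi - lo) + 1) + 1 := by
      intro lo' hi' hle h
      -- An empty remaining interval is treated apart: `Nat.log 2 0 = Nat.log 2 1 = 0`, so the
      -- logarithm need not drop. Otherwise `hi - lo ≥ 2` and it drops by one.
      rcases Nat.eq_zero_or_pos (hi' - lo') with h0 | h0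
      · have : (binarySearch p lo' hi').steps = 1 := by
          rw [binarySearch, dif_neg (by omega)]; rfl
        rw [this]
        nlinarith [Nat.zero_le (Nat.log 2 (hi - lo))]
      · have hc : Nat.log 2 (hi - lo) = Nat.log 2 ((hi - lo) / 2) + 1 := by
          rw [Nat.log_of_one_lt_of_le (by norm_num) (by omega)]
        have hm : Nat.log 2 (hi' - lo') ≤ Nat.log 2 ((hi - lo) / 2) := Nat.log_mono_right hle
        rw [hc]
        have := Nat.mul_le_mul_left (k + 3) hm
        nlinarith
    split
    · exact key _ _ (by omega) ih1
    · exact key _ _ (by omega) ih2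
  | case2 lo hi hlt => simp

end Lists
end Timed

open Timed

/-! ### Mean shift clustering. -/

theorem prefixSums_steps (acc : ℝ) (w : List ℝ) : (prefixSums acc w).steps = 3 * w.length + 1 := by
  induction w generalizing acc with
  | nil => simp [prefixSums]
  | cons a w ih => simp [prefixSums, ih]; ring

/-- Partial sums make the mean of a window available in constant time, so only the two binary
searches depend on the length. -/
theorem shiftOnce_steps_le (b : ℝ) (w S : List ℝ) (c : ℝ) :
    (shiftOnce b w S c).steps ≤ 12 * (Nat.log 2 w.length + 1) + 8 := by
  have h1 := binarySearch_steps_le (fun k => ops 3 (decide (c + b < w.getD k 0))) 3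
    (fun _ => le_rfl) 0 w.length
  have h2 := binarySearch_steps_le (fun k => ops 3 (decide (c - b ≤ w.getD k 0))) 3
    (fun _ => le_rfl) 0 w.length
  simp only [shiftOnce, bind_steps, ops_steps, Nat.sub_zero] at *
  omega

theorem shiftIter_steps_le (b tol : ℝ) (w S : List ℝ) (T : ℕ) (c : ℝ) :
    (shiftIter b tol w S T c).steps ≤ T * (12 * (Nat.log 2 w.length + 1) + 11) := by
  induction T generalizing c with
  | zero => simp [shiftIter]
  | succ T ih =>
    have h1 := shiftOnce_steps_le b w S c
    have h2 := ih (shiftOnce b w S c).val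
    rw [Nat.succ_mul]
    simp only [shiftIter, bind_steps, ops_steps, ops_val, decide_eq_true_eq]
    split
    · rw [pure_steps]; omega
    · omega

theorem labelModes_steps (b prev : ℝ) (lab : ℕ) (ms : List ℝ) :
    (labelModes b prev lab ms).steps = 6 * ms.length := by
  induction ms generalizing prev lab with
  | nil => simp [labelModes]
  | cons a w ih => simp [labelModes, ih]; ring

theorem labelModes_length (b prev : ℝ) (lab : ℕ) (ms : List ℝ) :
    (labelModes b prev lab ms).val.length = ms.length := by
  induction ms generalizing prev lab with
  | nil => simp [labelModes]
  | cons a w ih => simp [labelModes, ih]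

theorem meanShift_steps_le (cfg : Settings) (w : List ℝ) :
    (meanShift cfg w).steps ≤
      (cfg.shiftIters * (12 * (Nat.log 2 w.length + 1) + 11) + 10) * w.length + 1 := by
  have h := mapList_steps_le _ _ (shiftIter_steps_le cfg.bandwidth cfg.shiftTol w
    (prefixSums 0 w).val cfg.shiftIters) w
  simp only [meanShift, bind_steps, prefixSums_steps, labelModes_steps, mapList_val,
    List.length_map]
  nlinarith

theorem meanShift_length (cfg : Settings) (w : List ℝ) :
    (meanShift cfg w).val.length = w.length := by
  simp [meanShift, labelModes_length, mapList_val]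

/-! ### Cost and result of the ego network computation. -/

namespace LinkTask

variable (P : LinkTask)

theorem egoNetwork_val_subset (cfg : Settings) (x : ℕ) (i : P.V) :
    (P.egoNetwork cfg x i).val ⊆ P.nbhd i := by
  intro j hj
  simp only [egoNetwork, bind_val, ops_val, List.mem_toFinset] at hj
  have := List.mem_of_mem_take hj
  rw [(mergeSort_perm _ _).mem_iff] at this
  simpa using this

/-- Sorting and the mean shift searches are the only superlinear parts; `23 = 12 + 11` is the cost
of one mean shift iteration per alter. The factors `+ 1` keep the bound valid for an ego with at
most one neighbour, where `Nat.log` vanishes. -/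
theorem egoNetwork_steps_le (cfg : Settings) (x : ℕ) (i : P.V) :
    (P.egoNetwork cfg x i).steps ≤ (40 + 23 * cfg.shiftIters) *
      (((P.nbhd i).card + 1) * (Nat.log 2 (P.nbhd i).card + 1)) := by
  set N := (P.nbhd i).card with hN
  set le : P.V → P.V → Bool := fun j k => decide (P.freq i k ≤ P.freq i j) with hle
  set alters := (mergeSort le (P.nbhd i).toList).val with halters
  have hlen : alters.length = N := by
    rw [halters, (mergeSort_perm _ _).length_eq, Finset.length_toList]
  set w := (mapList (fun j => ops 1 (P.freq i j)) alters).val with hw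
  have hwlen : w.length = N := by rw [hw, mapList_val, List.length_map, hlen]
  set p : ℕ → Timed Bool := fun k => ops 2 (decide (1 ≤ w.getD k 0)) with hp
  set m := (binarySearch p 0 w.length).val with hm
  set labels := (meanShift cfg (w.take m)).val with hlabels
  have hlablen : labels.length ≤ N := by
    rw [hlabels, meanShift_length, List.length_take]; omega
  set q : ℕ → Timed Bool := fun k => ops 2 (decide (labels.getD k 0 ≤ x)) with hq
  have hsteps : (P.egoNetwork cfg x i).steps = (mergeSort le (P.nbhd i).toList).steps +
    ((mapList (fun j => ops 1 (P.freq i j)) alters).steps +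
    ((binarySearch p 0 w.length).steps + ((meanShift cfg (w.take m)).steps +
    ((binarySearch q 0 labels.length).steps + (binarySearch q 0 labels.length).val)))) := rfl
  rw [hsteps]
  have h1 := mergeSort_steps_le le (P.nbhd i).toList
  rw [Finset.length_toList, ← hN] at h1
  have h2 := mapList_steps_le (fun j => ops 1 (P.freq i j)) 1 (fun _ => le_rfl) alters
  have h3 := binarySearch_steps_le p 2 (fun _ => le_rfl) 0 w.length
  have h4 := meanShift_steps_le cfg (w.take m)
  have h5 := binarySearch_steps_le q 2 (fun _ => le_rfl) 0 labels.length
  have h6 := binarySearch_val_le q 0 labels.length (Nat.zero_le _)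
  set l := Nat.log 2 N with hl
  have hclog : Nat.clog 2 N ≤ l + 1 := by
    rw [Nat.clog_le_iff_le_pow (by norm_num)]
    exact (Nat.lt_pow_succ_log_self (by norm_num) N).le
  have h1' := Nat.mul_le_mul_left N hclog
  rw [hlen] at h2
  have h3' : Nat.log 2 (w.length - 0) = l := by rw [hwlen, Nat.sub_zero]
  rw [h3'] at h3
  have h5' : Nat.log 2 (labels.length - 0) ≤ l := Nat.log_mono_right (by omega)
  have hwm : (w.take m).length ≤ N := by rw [List.length_take]; omega
  have h4' : Nat.log 2 (w.take m).length ≤ l := Nat.log_mono_right hwm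
  have h4'' : (meanShift cfg (w.take m)).steps ≤
      (cfg.shiftIters * (12 * (l + 1) + 11) + 10) * N + 1 := by
    refine h4.trans ?_
    gcongr
  have h7 : N ≤ N * (l + 1) := Nat.le_mul_of_pos_right _ (by omega)
  have h8 : cfg.shiftIters * N ≤ cfg.shiftIters * (N * (l + 1)) := Nat.mul_le_mul_left _ h7
  have h9 : (cfg.shiftIters * (12 * (l + 1) + 11) + 10) * N =
      12 * (cfg.shiftIters * (N * (l + 1))) + 11 * (cfg.shiftIters * N) + 10 * N := by ring
  have h10 : (40 + 23 * cfg.shiftIters) * ((N + 1) * (l + 1)) =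
      40 * (N * (l + 1)) + 40 * (l + 1) + 23 * (cfg.shiftIters * (N * (l + 1))) +
        23 * (cfg.shiftIters * (l + 1)) := by ring
  rw [h10]
  rw [h9] at h4''
  -- What remains is linear in the products `N * (l + 1)`, `shiftIters * N` and the like, treated as
  -- atoms.
  clear_value N l m w labels alters p q
  omega

theorem le_egoNetwork_steps (cfg : Settings) (x : ℕ) (i : P.V) :
    (P.nbhd i).card * Nat.log 2 (P.nbhd i).card ≤ (P.egoNetwork cfg x i).steps := by
  have h := le_mergeSort_steps (fun j k => decide (P.freq i k ≤ P.freq i j)) (P.nbhd i).toList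
  rw [Finset.length_toList] at h
  simp only [egoNetwork, bind_steps]
  omega

theorem egoPhase_all_steps (cfg : Settings) : (P.egoPhase cfg .all).steps = 0 := rfl

theorem egoPhase_circle_steps (cfg : Settings) (x : ℕ) :
    (P.egoPhase cfg (.circle x)).steps = ∑ i ∈ P.egos, ((P.egoNetwork cfg x i).steps + 1) := by
  rw [← Finset.sum_coe_sort]
  rfl

theorem sliced_all (cfg : Settings) : P.sliced cfg .all = P.nbhd := rfl

theorem sliced_circle_subset (cfg : Settings) (x : ℕ) (i : P.V) :
    P.sliced cfg (.circle x) i ⊆ P.nbhd i := by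
  simp only [sliced, egoPhase, bind_val, pure_val]
  split
  · exact P.egoNetwork_val_subset cfg x i
  · simp

theorem sliced_subset (cfg : Settings) (s : Slicing) (i : P.V) :
    P.sliced cfg s i ⊆ P.nbhd i := by
  cases s with
  | all => exact subset_rfl
  | circle x => exact P.sliced_circle_subset cfg x i

/-! ### Features -/

theorem foldl_filter_mem (b : Finset P.V) (l acc : List P.V) :
    l.foldl (fun acc z => ((do
      let found ← ops 1 (decide (z ∈ b))
      if found then ops 1 (z :: acc) else pure acc) : Timed (List P.V)).val) acc
      = (l.filter (· ∈ b)).reverse ++ acc := by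
  induction l generalizing acc with
  | nil => simp
  | cons z l ih =>
    rw [List.foldl_cons, ih]
    by_cases h : z ∈ b <;> simp [h]

/-- Only a permutation, since the order depends on which table is scanned; lengths and sums do not
see it. -/
theorem intersect_val_perm (s t : Finset P.V) :
    (P.intersect s t).val.Perm (s ∩ t).toList := by
  have key : ∀ a b : Finset P.V, ((a.toList.filter (· ∈ b)).reverse ++ []).Perm
      (a ∩ b).toList := by
    intro a b
    rw [List.append_nil]
    refine (List.reverse_perm _).trans ?_
    rw [List.perm_ext_iff_of_nodup ((Finset.nodup_toList _).filter _) (Finset.nodup_toList _)]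
    simp
  simp only [intersect, bind_val, ops_val, decide_eq_true_eq]
  split
  · rw [foldList_val, foldl_filter_mem]
    exact key s t
  · rw [foldList_val, foldl_filter_mem, Finset.inter_comm]
    exact key t s

theorem intersect_steps (s t : Finset P.V) :
    (P.intersect s t).steps = 3 + 2 * min s.card t.card + (s ∩ t).card := by
  have key : ∀ a b : Finset P.V, (foldList (fun (acc : List P.V) z => do
      let found ← ops 1 (decide (z ∈ b))
      if found then ops 1 (z :: acc) else pure acc) [] a.toList).steps
      = 2 * a.card + (a ∩ b).card := by
    intro a b
    rw [foldList_steps_eq_sum _ (fun z => 1 + if z ∈ b then 1 else 0) (fun s z => by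
      simp only [bind_steps, ops_steps, ops_val, decide_eq_true_eq]
      split <;> simp)]
    rw [Finset.sum_map_toList a (fun z => 1 + (if z ∈ b then 1 else 0) + 1)]
    rw [Finset.sum_add_distrib, Finset.sum_add_distrib, ← Finset.card_filter,
      Finset.filter_mem_eq_inter]
    simp
    omega
  simp only [intersect, bind_steps, ops_steps, ops_val, decide_eq_true_eq]
  split
  · rw [key, min_eq_left ‹_›]; omega
  · rw [key, Finset.inter_comm, min_eq_right (by omega)]; omega

theorem intersect_length (s t : Finset P.V) : (P.intersect s t).val.length = (s ∩ t).card := by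
  rw [(P.intersect_val_perm s t).length_eq, Finset.length_toList]

theorem foldl_add_eq_sum {α : Type} (g : α → ℝ) (l : List α) (acc : ℝ) :
    l.foldl (fun acc z => acc + g z) acc = acc + (l.map g).sum := by
  induction l generalizing acc with
  | nil => simp
  | cons z l ih => rw [List.foldl_cons, ih]; simp [add_assoc]

theorem heuristic_val (h : Heuristic) (Γω : P.V → Finset P.V) (i j : P.V) :
    (P.heuristic h (Γω i) (Γω j)).val = P.similarity h Γω i j := by
  have hp := P.intersect_val_perm (Γω i) (Γω j)
  have hl := P.intersect_length (Γω i) (Γω j)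
  have hu := Finset.card_union_add_card_inter (Γω i) (Γω j)
  cases h with
  | CN => simp [heuristic, similarity, hl]
  | JC =>
    simp only [heuristic, similarity, bind_val, ops_val, hl]
    -- The denominators agree by inclusion and exclusion; an empty union needs no separate case.
    congr 1
    have : (((Γω i ∪ Γω j).card : ℝ)) + ((Γω i ∩ Γω j).card : ℝ) = (Γω i).card + (Γω j).card := by
      exact_mod_cast hu
    linarith
  | AA =>
    simp only [heuristic, similarity, bind_val, foldList_val, ops_val]
    rw [foldl_add_eq_sum (fun z => 1 / Real.log ((P.nbhd z).card : ℝ)), zero_add,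
      (hp.map _).sum_eq, Finset.sum_map_toList]
  | RA =>
    simp only [heuristic, similarity, bind_val, foldList_val, ops_val]
    rw [foldl_add_eq_sum (fun z => 1 / ((P.nbhd z).card : ℝ)), zero_add,
      (hp.map _).sum_eq, Finset.sum_map_toList]

/-- Each of the four heuristics computes the intersection anew, which gives `8 * min` and four steps
per common neighbour. The loops of Adamic-Adar and resource allocation add `5 + 4` per common
neighbour, hence `13`. -/
theorem featurePhase_steps (Γω : P.V → Finset P.V) :
    (P.featurePhase Γω).steps = ∑ p ∈ P.trainLinks,
      (24 + 8 * min (Γω p.1).card (Γω p.2).card + 13 * (Γω p.1 ∩ Γω p.2).card) := by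
  rw [← Finset.sum_coe_sort]
  simp only [featurePhase, forAll_steps]
  refine Finset.sum_congr rfl fun p _ => ?_
  have hl := P.intersect_length (Γω p.1.1) (Γω p.1.2)
  have hs := P.intersect_steps (Γω p.1.1) (Γω p.1.2)
  have h4 := foldList_steps_eq_sum (fun (acc : ℝ) (z : P.V) =>
      ops 4 (acc + 1 / Real.log ((P.nbhd z).card : ℝ))) (fun _ => 4) (fun _ _ => rfl)
      (P.intersect (Γω p.1.1) (Γω p.1.2)).val 0
  have h3 := foldList_steps_eq_sum (fun (acc : ℝ) (z : P.V) =>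
      ops 3 (acc + 1 / ((P.nbhd z).card : ℝ))) (fun _ => 3) (fun _ _ => rfl)
      (P.intersect (Γω p.1.1) (Γω p.1.2)).val 0
  simp only [List.map_const', List.sum_replicate, hl, smul_eq_mul] at h3 h4
  simp only [Fin.sum_univ_four, heuristics, Matrix.cons_val, heuristic, bind_steps, ops_steps,
    h3, h4, hs]
  omega

end LinkTask

/-! ### Running times of the learning algorithms -/

namespace Samples

variable {ι : Type} {d : ℕ}

theorem splitList_steps (D : Samples ι d) (f : Fin d) (thr : ℝ) (l : List ι) :
    (D.splitList f thr l).steps = 3 * l.length := by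
  induction l with
  | nil => simp [splitList]
  | cons a l ih => simp [splitList, ih]; ring

theorem splitList_length (D : Samples ι d) (f : Fin d) (thr : ℝ) (l : List ι) :
    (D.splitList f thr l).val.1.length + (D.splitList f thr l).val.2.length = l.length := by
  induction l with
  | nil => simp [splitList]
  | cons a l ih =>
    simp only [splitList, bind_val, ops_val, List.length_cons]
    split <;> simp only [List.length_cons] <;> omega

theorem scanFeature_steps_le (D : Samples ι d) (n p : ℝ) (best : Option (ℝ × Fin d × ℝ))
    (f : Fin d) (sorted : List ι) : (D.scanFeature n p best f sorted).steps ≤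
      30 * sorted.length := by
  simp only [scanFeature, bind_steps, pure_steps, Nat.add_zero]
  refine foldList_steps_le _ 29 (fun s i => ?_) _ _
  obtain ⟨nl, pl, last, best'⟩ := s
  cases last with
  | none => simp
  | some u =>
    simp only [bind_steps, ops_steps]
    split
    · cases best' <;> simp
    · simp

/-- Induction on the depth: the bound is additive in the lists, and the children's lists add up to
those of the node. The factor `33` is `30` for scanning and `3` for splitting. The lists `S f` need
not be related to `rows`. -/
theorem growTree_steps_le (D : Samples ι d) (cand : List Bool → Finset (Fin d))
    (depth : ℕ) (path : List Bool) (rows : List ι) (S : Fin d → List ι) :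
    (D.growTree cand depth path rows S).steps ≤ 6 + 4 * rows.length +
      depth * (33 * ∑ f, (S f).length + (2 * d + 16) * rows.length) := by
  induction depth generalizing path rows S with
  | zero =>
    rw [growTree]
    have h := foldList_steps_le (fun (np : ℝ × ℝ) (i : ι) =>
        ops 3 (np.1 + 1, np.2 + (if D.y i then 1 else 0))) 3 (fun _ _ => le_rfl) rows (0, 0)
    simp only [bind_steps, ops_steps, ops_val, decide_eq_true_eq]
    split <;> simp only [ops_steps] <;> omega
  | succ depth ih =>
    rw [growTree]
    have h := foldList_steps_le (fun (np : ℝ × ℝ) (i : ι) =>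
        ops 3 (np.1 + 1, np.2 + (if D.y i then 1 else 0))) 3 (fun _ _ => le_rfl) rows (0, 0)
    have hval : rows = [] → (foldList (fun (np : ℝ × ℝ) (i : ι) =>
        ops 3 (np.1 + 1, np.2 + (if D.y i then 1 else 0))) (0, 0) rows).val = (0, 0) := by
      rintro rfl; rfl
    simp only [bind_steps, ops_steps, ops_val, decide_eq_true_eq]
    generalize hnp : foldList (fun (np : ℝ × ℝ) (i : ι) =>
        ops 3 (np.1 + 1, np.2 + (if D.y i then 1 else 0))) (0, 0) rows = np at h hval ⊢
    split
    · simp only [ops_steps]; omega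
    · rename_i hpure
      -- A node without samples passes the purity test, so a splitting node has a row to which its
      -- constant overhead can be charged.
      have hrows : 1 ≤ rows.length := by
        rw [Nat.one_le_iff_ne_zero, Ne, List.length_eq_zero_iff]
        intro h0
        simp [hval h0] at hpure
      have hcand := foldList_steps_le_sum (fun b f => D.scanFeature np.val.1 np.val.2 b f (S f))
        (fun f => 30 * (S f).length) (fun _ _ => scanFeature_steps_le _ _ _ _ _ _)
        (cand path).toList none
      rw [Finset.sum_map_toList (cand path) (fun f => 30 * (S f).length + 1)] at hcand
      have hcand2 : ∑ f ∈ cand path, (30 * (S f).length + 1) ≤ 30 * ∑ f, (S f).length + d := by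
        refine (Finset.sum_le_sum_of_subset (Finset.subset_univ _)).trans (le_of_eq ?_)
        simp [Finset.sum_add_distrib, Finset.mul_sum]
      simp only [bind_steps]
      generalize foldList (fun b f => D.scanFeature np.val.1 np.val.2 b f (S f)) none
        (cand path).toList = best at hcand ⊢
      -- The overhead left over at a node, including the terms `6 + 4 * rows.length` of both
      -- children; equality at one row explains the `16`.
      have hm : 2 * d + 7 * rows.length + 9 ≤ (2 * d + 16) * rows.length := by nlinarith
      set Q := ∑ f, (S f).length with hQ
      rw [Nat.add_mul depth 1, Nat.one_mul]
      split
      · simp only [ops_steps]; omega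
      · rename_i b hb
        simp only [bind_steps, splitList_steps, forAll_steps, ops_steps, forAll_val]
        have hl := ih (false :: path) (D.splitList b.2.1 b.2.2 rows).val.1
          (fun f => (D.splitList b.2.1 b.2.2 (S f)).val.1)
        have hr := ih (true :: path) (D.splitList b.2.1 b.2.2 rows).val.2
          (fun f => (D.splitList b.2.1 b.2.2 (S f)).val.2)
        have hlen := D.splitList_length b.2.1 b.2.2 rows
        have hQs : ∑ f, (D.splitList b.2.1 b.2.2 (S f)).val.1.length +
            ∑ f, (D.splitList b.2.1 b.2.2 (S f)).val.2.length = Q := by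
          rw [← Finset.sum_add_distrib]
          exact Finset.sum_congr rfl fun f _ => D.splitList_length _ _ _
        have hS : ∑ f, (3 * (S f).length + 1) = 3 * Q + d := by
          simp [Finset.sum_add_distrib, Finset.mul_sum, hQ]
        rw [hS]
        have hadd : depth * (33 * ∑ f, (D.splitList b.2.1 b.2.2 (S f)).val.1.length +
              (2 * d + 16) * (D.splitList b.2.1 b.2.2 rows).val.1.length) +
            depth * (33 * ∑ f, (D.splitList b.2.1 b.2.2 (S f)).val.2.length +
              (2 * d + 16) * (D.splitList b.2.1 b.2.2 rows).val.2.length) =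
            depth * (33 * Q + (2 * d + 16) * rows.length) := by
          rw [← hQs, ← hlen]; ring
        omega

variable [Fintype ι]

theorem logisticEpoch_steps (D : Samples ι d) (rate : ℝ) (θ : (Fin d → ℝ) × ℝ) :
    (D.logisticEpoch rate θ).steps = Fintype.card ι * (5 * d + 9) +
      d * (5 * Fintype.card ι + 4) + 3 * Fintype.card ι + 2 := by
  simp [logisticEpoch]
  ring

theorem logisticIter_steps (D : Samples ι d) (rate : ℝ) (T : ℕ) (θ : (Fin d → ℝ) × ℝ) :
    (D.logisticIter rate T θ).steps = T * (Fintype.card ι * (5 * d + 9) +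
      d * (5 * Fintype.card ι + 4) + 3 * Fintype.card ι + 3) := by
  induction T generalizing θ with
  | zero => simp [logisticIter]
  | succ T ih =>
    simp only [logisticIter, bind_steps, tick_steps, ih, logisticEpoch_steps]
    ring

theorem trainLogistic_steps (D : Samples ι d) (cfg : Settings) :
    (D.trainLogistic cfg).steps = 2 * d + cfg.epochs * (Fintype.card ι * (5 * d + 9) +
      d * (5 * Fintype.card ι + 4) + 3 * Fintype.card ι + 3) := by
  simp only [trainLogistic, bind_steps, logisticIter_steps, forAll_steps, ops_steps, pure_steps]
  simp
  ring

theorem trainNaiveBayes_steps (D : Samples ι d) :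
    D.trainNaiveBayes.steps = 2 * (4 * Fintype.card ι + d * (5 * Fintype.card ι + 2) +
      d * (7 * Fintype.card ι + 2) + 1) := by
  simp only [trainNaiveBayes, bind_steps, forAll_steps, sumAll_steps, ops_steps, pure_steps]
  simp
  ring

theorem trainLogistic_steps_le (D : Samples ι d) (cfg : Settings) {m : ℕ}
    (hm : Fintype.card ι ≤ m) (hm1 : 1 ≤ m) (hd : 1 ≤ d) :
    (D.trainLogistic cfg).steps ≤ (2 + 29 * cfg.epochs) * (m * d) := by
  rw [trainLogistic_steps]
  have h1 : d ≤ m * d := Nat.le_mul_of_pos_left _ hm1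
  have h2 : m ≤ m * d := Nat.le_mul_of_pos_right _ hd
  have h3 : Fintype.card ι * d ≤ m * d := Nat.mul_le_mul_right _ hm
  have h4 : Fintype.card ι * (5 * d + 9) + d * (5 * Fintype.card ι + 4) +
      3 * Fintype.card ι + 3 ≤ 29 * (m * d) := by nlinarith
  have h5 := Nat.mul_le_mul_left cfg.epochs h4
  nlinarith

theorem trainNaiveBayes_steps_le (D : Samples ι d) {m : ℕ}
    (hm : Fintype.card ι ≤ m) (hm1 : 1 ≤ m) (hd : 1 ≤ d) :
    D.trainNaiveBayes.steps ≤ 42 * (m * d) := by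
  rw [trainNaiveBayes_steps]
  have h1 : d ≤ m * d := Nat.le_mul_of_pos_left _ hm1
  have h2 : m ≤ m * d := Nat.le_mul_of_pos_right _ hd
  have h3 : Fintype.card ι * d ≤ m * d := Nat.mul_le_mul_right _ hm
  nlinarith

/-- Here `19 = 7 + 2 + 6 + 4` collects the presorting and the depth-free part of
`growTree_steps_le`, and `51 = 33 + 2 + 16` the cost of one level when `d ≥ 1`. -/
theorem buildTree_steps_le (D : Samples ι d) (cfg : Settings)
    (cand : List Bool → Finset (Fin d)) (hn : 1 ≤ Fintype.card ι) (hd : 1 ≤ d) :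
    (D.buildTree cfg cand).steps ≤ (19 + 51 * cfg.depthFactor) *
      (Fintype.card ι * (Nat.log 2 (Fintype.card ι) + 1) * d) := by
  simp only [buildTree, bind_steps]
  set n := Fintype.card ι with hn'
  set l := Nat.log 2 n with hl
  have hlen : (univ : Finset ι).toList.length = n := by rw [Finset.length_toList]; rfl
  have hclog : Nat.clog 2 n ≤ l + 1 := by
    rw [Nat.clog_le_iff_le_pow (by norm_num)]
    exact (Nat.lt_pow_succ_log_self (by norm_num) n).le
  have h1 := forAll_steps_le (fun f : Fin d =>
    Timed.mergeSort (fun i j : ι => decide (D.x i f ≤ D.x j f)) (univ : Finset ι).toList)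
    (7 * (n * (l + 1)) + 1) (fun f => by
      refine (mergeSort_steps_le _ _).trans ?_
      rw [hlen]
      gcongr)
  have h2 := D.growTree_steps_le cand (cfg.maxDepth n) [] (univ : Finset ι).toList
    (forAll (fun f : Fin d => Timed.mergeSort (fun i j : ι => decide (D.x i f ≤ D.x j f))
      (univ : Finset ι).toList)).val
  have hS : ∑ f, ((forAll (fun f : Fin d => Timed.mergeSort
      (fun i j : ι => decide (D.x i f ≤ D.x j f)) (univ : Finset ι).toList)).val f).length
      = d * n := by
    simp [(mergeSort_perm _ _).length_eq, hn']
  rw [hS, hlen] at h2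
  rw [Fintype.card_fin] at h1
  have h3 : cfg.maxDepth n * (33 * (d * n) + (2 * d + 16) * n) ≤
      cfg.depthFactor * (l + 1) * (51 * (d * n)) := by
    refine Nat.mul_le_mul (cfg.maxDepth_le n) ?_
    nlinarith
  have h4 : d ≤ n * (l + 1) * d := Nat.le_mul_of_pos_left _ (by positivity)
  have h5 : n ≤ n * (l + 1) * d := by
    rw [mul_assoc]; exact Nat.le_mul_of_pos_right _ (by positivity)
  nlinarith

/-- Presorting by a single feature suffices, whatever the tree looks like. -/
theorem le_buildTree_steps (D : Samples ι d) (cfg : Settings)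
    (cand : List Bool → Finset (Fin d)) (hd : 1 ≤ d) :
    Fintype.card ι * Nat.log 2 (Fintype.card ι) ≤ (D.buildTree cfg cand).steps := by
  simp only [buildTree, bind_steps, forAll_steps]
  have h := Finset.single_le_sum (f := fun f : Fin d => (Timed.mergeSort
    (fun i j : ι => decide (D.x i f ≤ D.x j f)) (univ : Finset ι).toList).steps + 1)
    (fun _ _ => Nat.zero_le _) (mem_univ (⟨0, hd⟩ : Fin d))
  have h2 := le_mergeSort_steps (fun i j : ι => decide (D.x i ⟨0, hd⟩ ≤ D.x j ⟨0, hd⟩))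
    (univ : Finset ι).toList
  rw [Finset.length_toList, Finset.card_univ] at h2
  omega

theorem trainForest_steps (D : Samples ι d) (cfg : Settings) (k : ℕ) (boot : Fin k → ι → ι)
    (cand : Fin k → List Bool → Finset (Fin d)) :
    (D.trainForest cfg k boot cand).steps = ∑ t, (Fintype.card ι * (3 * d + 1) +
      3 * Fintype.card ι + (Samples.buildTree ⟨fun i f => D.x (boot t i) f,
        fun i => D.y (boot t i)⟩ cfg (cand t)).steps + 1) := by
  simp only [trainForest, bind_steps, pure_steps, Nat.add_zero]
  rw [forAll_steps]
  refine Finset.sum_congr rfl fun t _ => ?_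
  simp only [bind_steps, forAll_steps, ops_steps, Finset.sum_const, Finset.card_univ,
    Fintype.card_fin, smul_eq_mul]
  have : (forAll fun i => forAll fun f : Fin d => ops 2 (D.x (boot t i) f)).val =
    fun i f => D.x (boot t i) f := rfl
  rw [this]
  have : (forAll fun i => ops 2 (D.y (boot t i))).val = fun i => D.y (boot t i) := rfl
  rw [this]
  ring

theorem trainForest_steps_le (D : Samples ι d) (cfg : Settings) (k : ℕ) (boot : Fin k → ι → ι)
    (cand : Fin k → List Bool → Finset (Fin d)) (hn : 1 ≤ Fintype.card ι) (hd : 1 ≤ d) :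
    (D.trainForest cfg k boot cand).steps ≤ (27 + 51 * cfg.depthFactor) *
      (Fintype.card ι * (Nat.log 2 (Fintype.card ι) + 1) * d * k) := by
  rw [trainForest_steps]
  refine (Finset.sum_le_card_nsmul _ _ ((27 + 51 * cfg.depthFactor) *
      (Fintype.card ι * (Nat.log 2 (Fintype.card ι) + 1) * d)) fun t _ => ?_).trans
      (le_of_eq ?_)
  · have h := buildTree_steps_le ⟨fun i f => D.x (boot t i) f, fun i => D.y (boot t i)⟩ cfg
      (cand t) hn hd
    set n := Fintype.card ι
    set l := Nat.log 2 n
    have h5 : n * d ≤ n * (l + 1) * d :=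
      Nat.mul_le_mul_right _ (Nat.le_mul_of_pos_right _ (by positivity))
    have h6 : n ≤ n * d := Nat.le_mul_of_pos_right _ hd
    nlinarith
  · simp; ring

theorem le_trainForest_steps (D : Samples ι d) (cfg : Settings) (k : ℕ) (boot : Fin k → ι → ι)
    (cand : Fin k → List Bool → Finset (Fin d)) (hk : 1 ≤ k) (hd : 1 ≤ d) :
    Fintype.card ι * Nat.log 2 (Fintype.card ι) ≤ (D.trainForest cfg k boot cand).steps := by
  rw [trainForest_steps]
  refine le_trans ?_ (Finset.single_le_sum (fun _ _ => Nat.zero_le _)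
    (mem_univ (⟨0, hk⟩ : Fin k)))
  have h := le_buildTree_steps ⟨fun i f => D.x (boot ⟨0, hk⟩ i) f,
    fun i => D.y (boot ⟨0, hk⟩ i)⟩ cfg (cand ⟨0, hk⟩) hd
  omega

theorem kernelEval_steps_le (ker : SvmKernel) (u v : Fin d → ℝ) :
    (kernelEval ker u v).steps ≤ 5 * d + 3 := by
  cases ker <;> simp [kernelEval] <;> omega

variable [DecidableEq ι]

theorem smo_steps_le (D : Samples ι d) (box tol : ℝ) (K : ι × ι → ℝ) (T : ℕ) (a F : ι → ℝ) :
    (D.smo box tol K T a F).steps ≤ T * (24 * Fintype.card ι + 35) := by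
  classical
  induction T generalizing a F with
  | zero => simp [smo]
  | succ T ih =>
    rw [smo, Nat.succ_mul]
    simp only [bind_steps]
    generalize hu : foldList _ (none : Option ι) (univ : Finset ι).toList = up
    generalize hv : foldList _ (none : Option ι) (univ : Finset ι).toList = down
    have h1 : up.steps ≤ 8 * Fintype.card ι := by
      rw [← hu, ← Finset.card_univ, ← Finset.length_toList]
      exact foldList_steps_le _ 7 (fun _ _ => le_rfl) _ _
    have h2 : down.steps ≤ 8 * Fintype.card ι := by
      rw [← hv, ← Finset.card_univ, ← Finset.length_toList]
      exact foldList_steps_le _ 7 (fun _ _ => le_rfl) _ _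
    clear hu hv
    split
    · rename_i i j _ _
      simp only [bind_steps, ops_steps, ops_val, decide_eq_true_eq]
      split
      · simp only [pure_steps]; omega
      · simp only [bind_steps, ops_steps, forAll_steps, Finset.sum_const, Finset.card_univ,
          smul_eq_mul]
        -- Passes under the eight costs that precede the recursive call, to apply the induction
        -- hypothesis to the updated multipliers.
        refine le_trans (Nat.add_le_add_left (Nat.add_le_add_left (Nat.add_le_add_left
          (Nat.add_le_add_left (Nat.add_le_add_left (Nat.add_le_add_left (Nat.add_le_add_left
          (Nat.add_le_add_left (ih _ _) _) _) _) _) _) _) _) _) ?_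
        omega
    · simp only [pure_steps]; omega

/-- There are at most `passes * n` iterations of linear cost, so optimization is quadratic, like the
kernel matrix. The `+ 1` covers the constant overhead for `n = 0`. -/
theorem trainSvm_steps_le (D : Samples ι d) (cfg : Settings) :
    (D.trainSvm cfg).steps ≤ (26 + 5 * d + 59 * cfg.passes) * (Fintype.card ι ^ 2 + 1) := by
  have hK := forAll_steps_le (fun p : ι × ι => kernelEval cfg.kernel (D.x p.1) (D.x p.2))
    (5 * d + 3) (fun p => kernelEval_steps_le _ _ _)
  rw [Fintype.card_prod] at hK
  simp only [trainSvm, bind_steps, pure_steps, ops_steps, forAll_steps (fun _ : ι => ops 1 _),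
    forAll_steps (fun _ : ι => ops 2 _), sumAll_steps, Finset.sum_const, Finset.card_univ,
    smul_eq_mul]
  have hs := D.smo_steps_le cfg.box cfg.svmTol
    (forAll fun p : ι × ι => kernelEval cfg.kernel (D.x p.1) (D.x p.2)).val
    (cfg.passes * Fintype.card ι) (forAll fun _ : ι => ops 1 (0 : ℝ)).val
    (forAll fun i : ι => ops 2 (-D.sgn i)).val
  set n := Fintype.card ι
  have hn : n ≤ n ^ 2 := Nat.le_self_pow (by norm_num) n
  have h1 : cfg.passes * n ≤ cfg.passes * n ^ 2 := Nat.mul_le_mul_left _ hn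
  nlinarith [Nat.zero_le (5 * d + 59 * cfg.passes)]

/-- The kernel matrix alone takes `n²` loop passes, and `log₂ n ≤ n`. -/
theorem le_trainSvm_steps (D : Samples ι d) (cfg : Settings) :
    Fintype.card ι * Nat.log 2 (Fintype.card ι) ≤ (D.trainSvm cfg).steps := by
  have h : Fintype.card ι * Fintype.card ι ≤ (forAll (fun p : ι × ι =>
      kernelEval cfg.kernel (D.x p.1) (D.x p.2))).steps := by
    rw [forAll_steps, ← Fintype.card_prod, ← Finset.card_univ, Finset.card_eq_sum_ones]
    exact Finset.sum_le_sum fun _ _ => by omega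
  have h2 := Nat.mul_le_mul_left (Fintype.card ι) (Nat.log_le_self 2 (Fintype.card ι))
  simp only [trainSvm, bind_steps]
  omega

end Samples

/-! ### Logarithms -/

theorem one_le_two_mul_log {x : ℝ} (hx : 2 ≤ x) : 1 ≤ 2 * Real.log x := by
  have h1 := Real.log_two_gt_d9
  have h2 := Real.log_le_log (by norm_num) hx
  linarith

/-- Uses `log 2 ≥ 1/2`; the reverse comparison below uses `log 2 ≤ 1`. -/
theorem natLog_le_two_mul_log {n : ℕ} {x : ℝ} (hn : (n : ℝ) ≤ x) (hx : 1 ≤ x) :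
    (Nat.log 2 n : ℝ) ≤ 2 * Real.log x := by
  rcases Nat.eq_zero_or_pos n with rfl | h0
  · simpa using Real.log_nonneg hx
  · have h1 : ((2 ^ Nat.log 2 n : ℕ) : ℝ) ≤ n := by
      exact_mod_cast Nat.pow_log_le_self 2 h0.ne'
    have h2 := Real.log_le_log (by positivity) (h1.trans hn)
    rw [Nat.cast_pow, Real.log_pow] at h2
    have h3 := Real.log_two_gt_d9
    push_cast at h2
    nlinarith [Nat.cast_nonneg (α := ℝ) (Nat.log 2 n)]

theorem log_le_natLog_add_one (n : ℕ) : Real.log n ≤ Nat.log 2 n + 1 := by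
  rcases Nat.eq_zero_or_pos n with rfl | h0
  · simp
  · have h1 : (n : ℝ) ≤ ((2 ^ (Nat.log 2 n + 1) : ℕ) : ℝ) := by
      exact_mod_cast (Nat.lt_pow_succ_log_self (by norm_num) n).le
    have h2 := Real.log_le_log (by positivity) h1
    rw [Nat.cast_pow, Real.log_pow] at h2
    have h3 := Real.log_two_lt_d9
    push_cast at h2
    nlinarith [Nat.cast_nonneg (α := ℝ) (Nat.log 2 n)]

namespace LinkTask

variable (P : LinkTask)

/-! ### Numbers of links -/

theorem card_trainLinks : P.trainLinks.card = P.egoLinks.card + P.negatives.card := by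
  refine Finset.card_union_of_disjoint (Finset.disjoint_left.2 fun p hp hn => ?_)
  exact (P.negatives_spec p hn).2.2.2 (Finset.mem_filter.1 hp).2.2

theorem card_link : Fintype.card P.Link = P.trainLinks.card := Fintype.card_coe _

theorem trainLinks_subset : P.trainLinks ⊆ P.egos ×ˢ P.egos := by
  intro p hp
  rcases Finset.mem_union.1 hp with h | h
  · exact (Finset.mem_filter.1 h).1
  · have := P.negatives_spec p h
    exact Finset.mem_product.2 ⟨this.1, this.2.1⟩

theorem fst_mem_egos {p : P.V × P.V} (hp : p ∈ P.trainLinks) : p.1 ∈ P.egos :=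
  (Finset.mem_product.1 (P.trainLinks_subset hp)).1

theorem snd_mem_egos {p : P.V × P.V} (hp : p ∈ P.trainLinks) : p.2 ∈ P.egos :=
  (Finset.mem_product.1 (P.trainLinks_subset hp)).2

theorem Undersampled.card_trainLinks {P : LinkTask} (h : P.Undersampled) :
    P.trainLinks.card = 2 * P.egoLinks.card := by
  rw [P.card_trainLinks, h]; ring

theorem card_trainLinks_le : P.trainLinks.card ≤ P.egos.card ^ 2 := by
  refine (Finset.card_le_card P.trainLinks_subset).trans ?_
  rw [Finset.card_product, sq]

/-- Every ordered pair of distinct egos is, possibly after a swap, increasing, and then it is either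
a link or a missing link. -/
theorem le_card_links_add_card_missingLinks :
    P.egos.card * P.egos.card - P.egos.card ≤ 2 * (P.egoLinks.card + P.missingLinks.card) := by
  have hsub : P.egos.offDiag ⊆ (P.egoLinks ∪ P.missingLinks) ∪
      (P.egoLinks ∪ P.missingLinks).image Prod.swap := by
    rintro ⟨i, j⟩ hp
    rw [Finset.mem_offDiag] at hp
    simp only [egoLinks, missingLinks, mem_union, mem_filter, mem_product, mem_image,
      Prod.exists, Prod.swap_prod_mk, Prod.mk.injEq]
    rcases lt_or_gt_of_ne hp.2.2 with h | h
    · left; by_cases ha : P.graph.Adj i j <;> simp_all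
    · right; refine ⟨j, i, ?_, rfl, rfl⟩
      by_cases ha : P.graph.Adj j i <;> simp_all
  have h := Finset.card_le_card hsub
  rw [Finset.offDiag_card] at h
  have h1 := Finset.card_union_le (P.egoLinks ∪ P.missingLinks)
    ((P.egoLinks ∪ P.missingLinks).image Prod.swap)
  have h2 := Finset.card_image_le (s := P.egoLinks ∪ P.missingLinks) (f := Prod.swap)
  have h3 := Finset.card_union_le P.egoLinks P.missingLinks
  omega

/-- Nine times the pair count is at most `18` times links plus missing links, and `18` times the
missing links is at most `20` times the negatives. -/
theorem FullDataset.le_card_trainLinks {P : LinkTask} (h : P.FullDataset) :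
    9 * (P.nEgos * (P.nEgos - 1)) ≤ 20 * (P.trainLinks.card : ℝ) := by
  have h1 := P.le_card_links_add_card_missingLinks
  have h2 : 9 * P.missingLinks.card ≤ 10 * P.negatives.card := h
  have h3 : 9 * (P.egos.card * P.egos.card) ≤ 20 * P.trainLinks.card + 9 * P.egos.card := by
    rw [P.card_trainLinks]; omega
  have h4 : 9 * ((P.egos.card : ℝ) * P.egos.card) ≤
      20 * (P.trainLinks.card : ℝ) + 9 * P.egos.card := by exact_mod_cast h3
  simp only [nEgos]
  linarith

/-- A link is found in the neighbourhood of its first endpoint. -/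
theorem card_egoLinks_le : P.egoLinks.card ≤ ∑ i ∈ P.egos, (P.nbhd i).card := by
  have hsub : P.egoLinks ⊆ P.egos.biUnion fun i => (P.nbhd i).image (Prod.mk i) := by
    rintro ⟨i, j⟩ hp
    simp only [egoLinks, mem_filter, mem_product] at hp
    simp [nbhd, hp]
  exact (Finset.card_le_card hsub).trans (Finset.card_biUnion_le.trans
    (Finset.sum_le_sum fun i _ => Finset.card_image_le))

theorem nLinks_le {cfg : Settings} {Δ : ℝ} (h : P.SizeLE cfg .all Δ) :
    P.nLinks ≤ Δ * P.nEgos := by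
  have h1 : P.nLinks ≤ ∑ i ∈ P.egos, ((P.nbhd i).card : ℝ) := by
    rw [nLinks]
    exact_mod_cast P.card_egoLinks_le
  refine h1.trans ((Finset.sum_le_card_nsmul _ _ Δ fun i hi => h i hi).trans (le_of_eq ?_))
  rw [nsmul_eq_mul, mul_comm]; rfl

theorem nLinks_nonneg : 0 ≤ P.nLinks := Nat.cast_nonneg _

theorem nEgos_nonneg : 0 ≤ P.nEgos := Nat.cast_nonneg _

variable {P} in
theorem SizeLE.mono {cfg : Settings} {s : Slicing} {δ δ' : ℝ} (h : P.SizeLE cfg s δ)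
    (hδ : δ ≤ δ') : P.SizeLE cfg s δ' := fun i hi => (h i hi).trans hδ

variable {P} in
theorem SizeLE.sliced {cfg : Settings} {δ : ℝ} (h : P.SizeLE cfg .all δ) (s : Slicing) :
    P.SizeLE cfg s δ := fun i hi =>
  (Nat.cast_le.2 (Finset.card_le_card (P.sliced_subset cfg s i))).trans (h i hi)

/-! ### Phases -/

theorem totalSteps_eq (cfg : Settings) (s : Slicing) (L : Learner P.Link 4) :
    P.totalSteps cfg s L = P.egoSteps cfg s + P.featureSteps cfg s + P.trainSteps cfg s L := by
  simp only [totalSteps, linkPrediction, bind_steps, egoSteps, featureSteps, trainSteps, sliced]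
  push_cast
  ring

theorem egoSteps_nonneg (cfg : Settings) (s : Slicing) : 0 ≤ P.egoSteps cfg s :=
  Nat.cast_nonneg _

theorem featureSteps_nonneg (cfg : Settings) (s : Slicing) : 0 ≤ P.featureSteps cfg s :=
  Nat.cast_nonneg _

theorem trainSteps_nonneg (cfg : Settings) (s : Slicing) (L : Learner P.Link 4) :
    0 ≤ P.trainSteps cfg s L := Nat.cast_nonneg _

theorem egoSteps_all (cfg : Settings) : P.egoSteps cfg .all = 0 := by
  simp [egoSteps, egoPhase_all_steps]

theorem egoSteps_circle_le (cfg : Settings) (x : ℕ) {Δ : ℝ} (hΔ : 2 ≤ Δ)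
    (h : P.SizeLE cfg .all Δ) : P.egoSteps cfg (.circle x) ≤
      8 * (41 + 23 * cfg.shiftIters) * (P.nEgos * (Δ * Real.log Δ)) := by
  rw [egoSteps, egoPhase_circle_steps, Nat.cast_sum]
  refine (Finset.sum_le_card_nsmul _ _ (8 * (41 + 23 * cfg.shiftIters) * (Δ * Real.log Δ))
    fun i hi => ?_).trans (le_of_eq ?_)
  · have h1 : (P.egoNetwork cfg x i).steps + 1 ≤ (41 + 23 * cfg.shiftIters) *
        (((P.nbhd i).card + 1) * (Nat.log 2 (P.nbhd i).card + 1)) := by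
      have := P.egoNetwork_steps_le cfg x i
      have : 1 ≤ ((P.nbhd i).card + 1) * (Nat.log 2 (P.nbhd i).card + 1) :=
        Nat.mul_pos (Nat.succ_pos _) (Nat.succ_pos _)
      nlinarith
    have h2 : (((P.egoNetwork cfg x i).steps + 1 : ℕ) : ℝ) ≤ (41 + 23 * cfg.shiftIters) *
        ((((P.nbhd i).card : ℝ) + 1) * (Nat.log 2 (P.nbhd i).card + 1)) := by exact_mod_cast h1
    refine h2.trans ?_
    have h3 : ((P.nbhd i).card : ℝ) ≤ Δ := h i hi
    have h4 := natLog_le_two_mul_log h3 (by linarith)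
    have h5 := one_le_two_mul_log hΔ
    -- Since `Δ ≥ 2`, each `+ 1` is absorbed: by `Δ` in the first factor, by `2 * log Δ` in the
    -- second.
    have h6 : (((P.nbhd i).card : ℝ) + 1) * (Nat.log 2 (P.nbhd i).card + 1) ≤
        (2 * Δ) * (4 * Real.log Δ) :=
      mul_le_mul (by linarith) (by linarith) (by positivity) (by linarith)
    calc _ ≤ (41 + 23 * cfg.shiftIters) * ((2 * Δ) * (4 * Real.log Δ)) := by gcongr
      _ = _ := by ring
  · rw [nsmul_eq_mul, nEgos]; ring

theorem exists_egoSteps_le (cfg : Settings) (Δ : ℝ) : ∃ C : ℝ, 0 < C ∧ ∀ (P : LinkTask),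
    P.SizeLE cfg .all Δ → ∀ s : Slicing, P.egoSteps cfg s ≤ C * P.nEgos := by
  have hΔ : (2 : ℝ) ≤ max Δ 2 := le_max_right _ _
  have hlog : 0 < Real.log (max Δ 2) := Real.log_pos (by linarith)
  refine ⟨8 * (41 + 23 * cfg.shiftIters) * (max Δ 2 * Real.log (max Δ 2)), by positivity, ?_⟩
  intro P hP s
  cases s with
  | all => rw [egoSteps_all]; have := P.nEgos_nonneg; positivity
  | circle x =>
    refine (P.egoSteps_circle_le cfg x hΔ (hP.mono (le_max_left _ _))).trans (le_of_eq ?_)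
    ring

/-- Sorting the neighbourhoods is enough; the `- 1` pays for rounding the binary logarithm down. -/
theorem le_egoSteps_circle (cfg : Settings) (x : ℕ) {Γ : ℝ} (hΓ : 1 ≤ Γ)
    (hlog : 1 ≤ Real.log Γ) (h : ∀ i ∈ P.egos, Γ ≤ ((P.nbhd i).card : ℝ)) :
    P.nEgos * (Γ * (Real.log Γ - 1)) ≤ P.egoSteps cfg (.circle x) := by
  rw [egoSteps, egoPhase_circle_steps, Nat.cast_sum, nEgos, ← nsmul_eq_mul]
  refine Finset.card_nsmul_le_sum _ _ _ fun i hi => ?_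
  have h1 : (P.nbhd i).card * Nat.log 2 (P.nbhd i).card ≤ (P.egoNetwork cfg x i).steps + 1 :=
    (P.le_egoNetwork_steps cfg x i).trans (Nat.le_succ _)
  have h2 : ((P.nbhd i).card : ℝ) * Nat.log 2 (P.nbhd i).card ≤
      (((P.egoNetwork cfg x i).steps + 1 : ℕ) : ℝ) := by exact_mod_cast h1
  refine le_trans ?_ h2
  have h3 := log_le_natLog_add_one (P.nbhd i).card
  have h4 := Real.log_le_log (by linarith) (h i hi)
  exact mul_le_mul (h i hi) (by linarith) (by linarith) (by positivity)

theorem featureSteps_eq (cfg : Settings) (s : Slicing) :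
    P.featureSteps cfg s = ∑ p ∈ P.trainLinks, (24 +
      8 * min ((P.sliced cfg s p.1).card : ℝ) ((P.sliced cfg s p.2).card : ℝ) +
      13 * ((P.sliced cfg s p.1 ∩ P.sliced cfg s p.2).card : ℝ)) := by
  rw [featureSteps, featurePhase_steps]
  push_cast
  rfl

theorem featureSteps_le (cfg : Settings) (s : Slicing) {δ : ℝ} (hδ : 1 ≤ δ)
    (h : P.SizeLE cfg s δ) : P.featureSteps cfg s ≤ 45 * (P.trainLinks.card * δ) := by
  rw [featureSteps_eq]
  refine (Finset.sum_le_card_nsmul _ _ (45 * δ) fun p hp => ?_).trans (le_of_eq ?_)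
  · have h1 := h _ (P.fst_mem_egos hp)
    have h2 : ((P.sliced cfg s p.1 ∩ P.sliced cfg s p.2).card : ℝ) ≤
        (P.sliced cfg s p.1).card := by
      exact_mod_cast Finset.card_le_card Finset.inter_subset_left
    have h3 := min_le_left ((P.sliced cfg s p.1).card : ℝ) ((P.sliced cfg s p.2).card : ℝ)
    linarith
  · rw [nsmul_eq_mul]; ring

theorem le_featureSteps (cfg : Settings) (s : Slicing) :
    (P.trainLinks.card : ℝ) ≤ P.featureSteps cfg s := by
  rw [featureSteps_eq, Finset.card_eq_sum_ones, Nat.cast_sum]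
  refine Finset.sum_le_sum fun p _ => ?_
  have h3 : 0 ≤ min ((P.sliced cfg s p.1).card : ℝ) ((P.sliced cfg s p.2).card : ℝ) :=
    le_min (Nat.cast_nonneg _) (Nat.cast_nonneg _)
  have h4 : 0 ≤ ((P.sliced cfg s p.1 ∩ P.sliced cfg s p.2).card : ℝ) := Nat.cast_nonneg _
  push_cast
  linarith

theorem card_mul_le_featureSteps_all (cfg : Settings) {Γ : ℝ}
    (h : ∀ i ∈ P.egos, Γ ≤ ((P.nbhd i).card : ℝ)) :
    P.trainLinks.card * Γ ≤ P.featureSteps cfg .all := by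
  rw [featureSteps_eq, ← nsmul_eq_mul]
  refine Finset.card_nsmul_le_sum _ _ _ fun p hp => ?_
  have h3 : Γ ≤ min ((P.sliced cfg .all p.1).card : ℝ) ((P.sliced cfg .all p.2).card : ℝ) :=
    le_min (h _ (P.fst_mem_egos hp)) (h _ (P.snd_mem_egos hp))
  have h5 : 0 ≤ min ((P.sliced cfg .all p.1).card : ℝ) ((P.sliced cfg .all p.2).card : ℝ) :=
    le_min (Nat.cast_nonneg _) (Nat.cast_nonneg _)
  have h4 : 0 ≤ ((P.sliced cfg .all p.1 ∩ P.sliced cfg .all p.2).card : ℝ) := Nat.cast_nonneg _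
  linarith

theorem featureSteps_circle_le (cfg : Settings) (x : ℕ) :
    P.featureSteps cfg (.circle x) ≤ P.featureSteps cfg .all := by
  rw [featureSteps_eq, featureSteps_eq, sliced_all]
  have hs := P.sliced_circle_subset cfg x
  gcongr <;> apply hs

/-- If both neighbourhoods of a link shrink, so does their minimum, by at least one. This saves
eight steps per link, of which one is kept. -/
theorem featureSteps_circle_add_le (cfg : Settings) (x : ℕ)
    (h : ∀ i ∈ P.egos, (P.sliced cfg (.circle x) i).card < (P.nbhd i).card) :
    P.featureSteps cfg (.circle x) + P.trainLinks.card ≤ P.featureSteps cfg .all := by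
  rw [featureSteps_eq, featureSteps_eq, sliced_all, Finset.card_eq_sum_ones, Nat.cast_sum,
    ← Finset.sum_add_distrib]
  refine Finset.sum_le_sum fun p hp => ?_
  have hs := P.sliced_circle_subset cfg x
  have h1 : ((P.sliced cfg (.circle x) p.1).card : ℝ) + 1 ≤ (P.nbhd p.1).card := by
    exact_mod_cast h _ (P.fst_mem_egos hp)
  have h2 : ((P.sliced cfg (.circle x) p.2).card : ℝ) + 1 ≤ (P.nbhd p.2).card := by
    exact_mod_cast h _ (P.snd_mem_egos hp)
  have h3 : ((P.sliced cfg (.circle x) p.1 ∩ P.sliced cfg (.circle x) p.2).card : ℝ) ≤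
      (P.nbhd p.1 ∩ P.nbhd p.2).card := by
    exact_mod_cast Finset.card_le_card (Finset.inter_subset_inter (hs _) (hs _))
  have h4 : min ((P.sliced cfg (.circle x) p.1).card : ℝ)
      ((P.sliced cfg (.circle x) p.2).card : ℝ) + 1 ≤
      min ((P.nbhd p.1).card : ℝ) ((P.nbhd p.2).card : ℝ) := by
    refine le_min (le_trans ?_ h1) (le_trans ?_ h2)
    · linarith [min_le_left ((P.sliced cfg (.circle x) p.1).card : ℝ)
        ((P.sliced cfg (.circle x) p.2).card : ℝ)]
    · linarith [min_le_right ((P.sliced cfg (.circle x) p.1).card : ℝ)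
        ((P.sliced cfg (.circle x) p.2).card : ℝ)]
  push_cast
  linarith

/-! ### Training -/

theorem natLog_add_one_mul_le {n : ℕ} {M : ℝ} (hn : (n : ℝ) ≤ M) (hM : 2 ≤ M) :
    (n : ℝ) * (Nat.log 2 n + 1) ≤ 4 * (M * Real.log M) := by
  have h1 := natLog_le_two_mul_log hn (by linarith)
  have h2 := one_le_two_mul_log hM
  have := mul_le_mul hn (show (Nat.log 2 n : ℝ) + 1 ≤ 4 * Real.log M by linarith)
    (by positivity) (by linarith)
  linarith

theorem trainStepsOn_logistic_le (cfg : Settings) {d m : ℕ} (hd : 1 ≤ d)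
    (X : P.Link → Fin d → ℝ) (hn : P.trainLinks.card ≤ m) (hm : 1 ≤ m) :
    P.trainStepsOn cfg .logistic X ≤ (2 + 29 * cfg.epochs) * ((m : ℝ) * d) := by
  have h := Samples.trainLogistic_steps_le ⟨X, P.label⟩ cfg (P.card_link.trans_le hn) hm hd
  have h2 : (((Samples.trainLogistic ⟨X, P.label⟩ cfg).steps : ℕ) : ℝ) ≤
    (2 + 29 * cfg.epochs) * ((m : ℝ) * d) := by exact_mod_cast h
  exact h2

theorem trainStepsOn_naiveBayes_le (cfg : Settings) {d m : ℕ} (hd : 1 ≤ d)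
    (X : P.Link → Fin d → ℝ) (hn : P.trainLinks.card ≤ m) (hm : 1 ≤ m) :
    P.trainStepsOn cfg .naiveBayes X ≤ 42 * ((m : ℝ) * d) := by
  have h := Samples.trainNaiveBayes_steps_le ⟨X, P.label⟩ (P.card_link.trans_le hn) hm hd
  have h2 : (((Samples.trainNaiveBayes ⟨X, P.label⟩).steps : ℕ) : ℝ) ≤
    42 * ((m : ℝ) * d) := by exact_mod_cast h
  exact h2

theorem trainStepsOn_decisionTree_le (cfg : Settings) {d : ℕ} (hd : 1 ≤ d)
    (X : P.Link → Fin d → ℝ) {M : ℝ} (h1 : 1 ≤ P.trainLinks.card)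
    (hn : (P.trainLinks.card : ℝ) ≤ M) (hM : 2 ≤ M) :
    P.trainStepsOn cfg .decisionTree X ≤
      4 * (27 + 51 * cfg.depthFactor) * (M * Real.log M * d) := by
  have h := Samples.buildTree_steps_le ⟨X, P.label⟩ cfg (fun _ => univ)
    (P.card_link.symm ▸ h1) hd
  rw [P.card_link] at h
  have h2 : P.trainStepsOn cfg .decisionTree X ≤ (19 + 51 * cfg.depthFactor) *
      ((P.trainLinks.card : ℝ) * (Nat.log 2 P.trainLinks.card + 1) * d) := by
    have h2 := (Nat.cast_le (α := ℝ)).2 h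
    push_cast at h2
    exact h2
  have h3 := natLog_add_one_mul_le hn hM
  calc _ ≤ _ := h2
    _ ≤ (27 + 51 * cfg.depthFactor) * (4 * (M * Real.log M) * d) := by gcongr; norm_num
    _ = _ := by ring

theorem trainStepsOn_randomForest_le (cfg : Settings) {d : ℕ} (hd : 1 ≤ d)
    (X : P.Link → Fin d → ℝ) {M : ℝ} (h1 : 1 ≤ P.trainLinks.card)
    (hn : (P.trainLinks.card : ℝ) ≤ M) (hM : 2 ≤ M) (k : ℕ) (hk : 1 ≤ k)
    (boot : Fin k → P.Link → P.Link) (cand : Fin k → List Bool → Finset (Fin d)) :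
    P.trainStepsOn cfg (.randomForest k hk boot cand) X ≤
      4 * (27 + 51 * cfg.depthFactor) * (M * Real.log M * d * k) := by
  have h := Samples.trainForest_steps_le ⟨X, P.label⟩ cfg k boot cand
    (P.card_link.symm ▸ h1) hd
  rw [P.card_link] at h
  have h2 : P.trainStepsOn cfg (.randomForest k hk boot cand) X ≤ (27 + 51 * cfg.depthFactor) *
      ((P.trainLinks.card : ℝ) * (Nat.log 2 P.trainLinks.card + 1) * d * k) := by
    have h2 := (Nat.cast_le (α := ℝ)).2 h
    push_cast at h2
    exact h2
  have h3 := natLog_add_one_mul_le hn hM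
  calc _ ≤ _ := h2
    _ ≤ (27 + 51 * cfg.depthFactor) * (4 * (M * Real.log M) * d * k) := by gcongr
    _ = _ := by ring

theorem trainStepsOn_svm_le (cfg : Settings) {d : ℕ} (X : P.Link → Fin d → ℝ) {M : ℝ}
    (hn : (P.trainLinks.card : ℝ) ≤ M) (hM : 2 ≤ M) :
    P.trainStepsOn cfg .svm X ≤ 2 * (26 + 5 * d + 59 * cfg.passes) * M ^ 2 := by
  have h := Samples.trainSvm_steps_le ⟨X, P.label⟩ cfg
  rw [P.card_link] at h
  have h2 : P.trainStepsOn cfg .svm X ≤ (26 + 5 * d + 59 * cfg.passes) *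
      ((P.trainLinks.card : ℝ) ^ 2 + 1) := by
    have h2 := (Nat.cast_le (α := ℝ)).2 h
    push_cast at h2
    exact h2
  have h3 : (P.trainLinks.card : ℝ) ^ 2 + 1 ≤ 2 * M ^ 2 := by
    have : (P.trainLinks.card : ℝ) ^ 2 ≤ M ^ 2 := by gcongr
    nlinarith
  calc _ ≤ _ := h2
    _ ≤ (26 + 5 * d + 59 * cfg.passes) * (2 * M ^ 2) := by gcongr
    _ = _ := by ring

theorem le_trainStepsOn (cfg : Settings) {d : ℕ} (hd : 1 ≤ d) (L : Learner P.Link d)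
    (X : P.Link → Fin d → ℝ) (hL : ¬ L.IsLogisticOrBayes) :
    (P.trainLinks.card : ℝ) * Nat.log 2 P.trainLinks.card ≤ P.trainStepsOn cfg L X := by
  have key : P.trainLinks.card * Nat.log 2 P.trainLinks.card ≤ (P.trainPhase cfg L X).steps := by
    rw [← P.card_link]
    cases L with
    | logistic => exact absurd trivial hL
    | naiveBayes => exact absurd trivial hL
    | decisionTree => exact Samples.le_buildTree_steps ⟨X, P.label⟩ cfg _ hd
    | randomForest k hk boot cand =>
      exact Samples.le_trainForest_steps ⟨X, P.label⟩ cfg k boot cand hk hd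
    | svm => exact Samples.le_trainSvm_steps ⟨X, P.label⟩ cfg
  rw [← Nat.cast_mul]
  exact Nat.cast_le.2 key

-- With `n = 2 * |E_e|` samples, `log₂ n` is one more than `log₂ |E_e|`, which compensates the
-- rounding; so the constant `1` works.
variable {P} in
theorem Undersampled.le_trainStepsOn (h : P.Undersampled) (cfg : Settings) {d : ℕ} (hd : 1 ≤ d)
    (L : Learner P.Link d) (X : P.Link → Fin d → ℝ) (hL : ¬ L.IsLogisticOrBayes) :
    P.nLinks * Real.log P.nLinks ≤ P.trainStepsOn cfg L X := by
  refine le_trans ?_ (P.le_trainStepsOn cfg hd L X hL)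
  rw [h.card_trainLinks, nLinks]
  rcases Nat.eq_zero_or_pos P.egoLinks.card with h0 | h0
  · simp [h0]
  · have h1 : Nat.log 2 (2 * P.egoLinks.card) = Nat.log 2 P.egoLinks.card + 1 := by
      rw [mul_comm, Nat.log_mul_base (by norm_num) h0.ne']
    rw [h1]
    have h2 := log_le_natLog_add_one P.egoLinks.card
    have h3 : (0 : ℝ) ≤ Real.log P.egoLinks.card := Real.log_natCast_nonneg _
    push_cast
    have h4 : (0 : ℝ) ≤ P.egoLinks.card := Nat.cast_nonneg _
    nlinarith [mul_le_mul_of_nonneg_left h2 h4, mul_nonneg h4 h3]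

/-- The loops of these two learners have no data-dependent branches, so their exact step counts
involve only the numbers of samples and features. In the comparison of baseline and circle the
training times therefore cancel. -/
theorem trainStepsOn_congr (cfg : Settings) {d : ℕ} (L : Learner P.Link d)
    (hL : L.IsLogisticOrBayes) (X X' : P.Link → Fin d → ℝ) :
    P.trainStepsOn cfg L X = P.trainStepsOn cfg L X' := by
  cases L with
  | logistic =>
    simp only [trainStepsOn, trainPhase, Learner.train, Samples.trainLogistic_steps]
  | naiveBayes =>
    simp only [trainStepsOn, trainPhase, Learner.train, Samples.trainNaiveBayes_steps]
  | _ => exact hL.elim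

variable {P} in
theorem Undersampled.trainStepsOn_le (h : P.Undersampled) (cfg : Settings) {d : ℕ} (hd : 1 ≤ d)
    (hE : 1 ≤ P.nLinks) (L : Learner P.Link d) (hL : L.IsLogisticOrBayes)
    (X : P.Link → Fin d → ℝ) :
    P.trainStepsOn cfg L X ≤ 2 * (42 + 29 * cfg.epochs) * (P.nLinks * d) := by
  have hE' : 1 ≤ P.egoLinks.card := Nat.one_le_cast.1 hE
  have hpos : 0 ≤ P.nLinks * d := mul_nonneg P.nLinks_nonneg (Nat.cast_nonneg _)
  have he : (0 : ℝ) ≤ cfg.epochs := Nat.cast_nonneg _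
  cases L with
  | logistic =>
    have := P.trainStepsOn_logistic_le cfg hd X h.card_trainLinks.le (by omega)
    push_cast at this
    refine this.trans ?_
    rw [nLinks] at *
    nlinarith
  | naiveBayes =>
    have := P.trainStepsOn_naiveBayes_le cfg hd X h.card_trainLinks.le (by omega)
    push_cast at this
    refine this.trans ?_
    rw [nLinks] at *
    nlinarith [mul_nonneg he hpos]
  | _ => exact hL.elim

end LinkTask

namespace LinkTask

/-! ### The parts of the main theorem -/

theorem exists_training_bounds (cfg : Settings) :
    ∃ C : ℝ, 0 < C ∧ ∃ C' : ℕ → ℝ, (∀ d, 0 < C' d) ∧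
      ∀ (P : LinkTask) (d : ℕ), 1 ≤ d → ∀ X : P.Link → Fin d → ℝ,
        (P.Undersampled → 2 ≤ P.nLinks →
          P.trainStepsOn cfg .logistic X ≤ C * (P.nLinks * d) ∧
          P.trainStepsOn cfg .naiveBayes X ≤ C * (P.nLinks * d) ∧
          P.trainStepsOn cfg .decisionTree X ≤ C * (P.nLinks * Real.log P.nLinks * d) ∧
          (∀ k hk boot cand, P.trainStepsOn cfg (.randomForest k hk boot cand) X ≤
            C * (P.nLinks * Real.log P.nLinks * d * k)) ∧
          P.trainStepsOn cfg .svm X ≤ C' d * P.nLinks ^ 2) ∧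
        (P.FullDataset → 2 ≤ P.nEgos →
          P.trainStepsOn cfg .logistic X ≤ C * (P.nEgos ^ 2 * d) ∧
          P.trainStepsOn cfg .naiveBayes X ≤ C * (P.nEgos ^ 2 * d) ∧
          P.trainStepsOn cfg .decisionTree X ≤ C * (P.nEgos ^ 2 * Real.log (P.nEgos ^ 2) * d) ∧
          (∀ k hk boot cand, P.trainStepsOn cfg (.randomForest k hk boot cand) X ≤
            C * (P.nEgos ^ 2 * Real.log (P.nEgos ^ 2) * d * k)) ∧
          P.trainStepsOn cfg .svm X ≤ C' d * P.nEgos ^ 4) := by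
  set A : ℝ := 4 * (27 + 51 * cfg.depthFactor) with hA
  set B : ℝ := 2 * (42 + 29 * cfg.epochs) with hB
  have hApos : 0 < A := by positivity
  have hBpos : 0 < B := by positivity
  refine ⟨4 * A + B, by positivity, fun d => 4 * (2 * (26 + 5 * d + 59 * cfg.passes)),
    fun d => by positivity, fun P d hd X => ⟨fun hU hE => ?_, fun hF hV => ?_⟩⟩
  · have hcard : (P.trainLinks.card : ℝ) = 2 * P.nLinks := by
      rw [hU.card_trainLinks, nLinks]; push_cast; rfl
    have h1 : 1 ≤ P.trainLinks.card := by
      have : (1 : ℝ) ≤ P.trainLinks.card := by rw [hcard]; linarith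
      exact_mod_cast this
    -- This is where `|E_e| ≥ 2` is needed: the factor two inside the logarithm costs at most
    -- another `log |E_e|`.
    have hlog : Real.log (2 * P.nLinks) ≤ 2 * Real.log P.nLinks := by
      rw [Real.log_mul (by norm_num) (by linarith)]
      linarith [Real.log_le_log (by norm_num) hE]
    have hlog0 : 0 ≤ Real.log P.nLinks := Real.log_nonneg (by linarith)
    have hM : 2 * P.nLinks * Real.log (2 * P.nLinks) ≤ 4 * (P.nLinks * Real.log P.nLinks) := by
      have := mul_le_mul_of_nonneg_left hlog (show 0 ≤ 2 * P.nLinks by linarith)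
      linarith
    have hpos : 0 ≤ P.nLinks * d := mul_nonneg P.nLinks_nonneg (Nat.cast_nonneg _)
    have hpos' : 0 ≤ P.nLinks * Real.log P.nLinks := mul_nonneg P.nLinks_nonneg hlog0
    refine ⟨?_, ?_, ?_, fun k hk boot cand => ?_, ?_⟩
    · exact (hU.trainStepsOn_le cfg hd (by linarith) .logistic trivial X).trans
        (by gcongr; linarith)
    · exact (hU.trainStepsOn_le cfg hd (by linarith) .naiveBayes trivial X).trans
        (by gcongr; linarith)
    · refine (P.trainStepsOn_decisionTree_le cfg hd X h1 hcard.le (by linarith)).trans ?_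
      calc _ ≤ A * (4 * (P.nLinks * Real.log P.nLinks) * d) := by gcongr
        _ = 4 * A * (P.nLinks * Real.log P.nLinks * d) := by ring
        _ ≤ _ := by gcongr; linarith
    · refine (P.trainStepsOn_randomForest_le cfg hd X h1 hcard.le (by linarith)
        k hk boot cand).trans ?_
      calc _ ≤ A * (4 * (P.nLinks * Real.log P.nLinks) * d * k) := by gcongr
        _ = 4 * A * (P.nLinks * Real.log P.nLinks * d * k) := by ring
        _ ≤ _ := by gcongr; linarith
    · exact (P.trainStepsOn_svm_le cfg X hcard.le (by linarith)).trans (le_of_eq (by ring))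
  · have hcard : (P.trainLinks.card : ℝ) ≤ P.nEgos ^ 2 := by
      rw [nEgos]; exact_mod_cast P.card_trainLinks_le
    have h1 : 1 ≤ P.trainLinks.card := by
      have h := hF.le_card_trainLinks
      have : (0 : ℝ) < P.trainLinks.card := by nlinarith
      exact_mod_cast this
    have hM : 2 ≤ P.nEgos ^ 2 := by nlinarith
    have hlog0 : 0 ≤ Real.log (P.nEgos ^ 2) := Real.log_nonneg (by linarith)
    have hV1 : 1 ≤ P.egos.card ^ 2 := h1.trans P.card_trainLinks_le
    refine ⟨?_, ?_, ?_, fun k hk boot cand => ?_, ?_⟩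
    · have h := P.trainStepsOn_logistic_le cfg hd X P.card_trainLinks_le hV1
      rw [Nat.cast_pow] at h
      refine h.trans (mul_le_mul_of_nonneg_right ?_ (by positivity))
      have : (0 : ℝ) ≤ cfg.epochs := Nat.cast_nonneg _
      linarith
    · have h := P.trainStepsOn_naiveBayes_le cfg hd X P.card_trainLinks_le hV1
      rw [Nat.cast_pow] at h
      refine h.trans (mul_le_mul_of_nonneg_right ?_ (by positivity))
      have : (0 : ℝ) ≤ cfg.epochs := Nat.cast_nonneg _
      linarith
    · refine (P.trainStepsOn_decisionTree_le cfg hd X h1 hcard hM).trans ?_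
      gcongr; linarith
    · refine (P.trainStepsOn_randomForest_le cfg hd X h1 hcard hM k hk boot cand).trans ?_
      gcongr; linarith
    · refine (P.trainStepsOn_svm_le cfg X hcard hM).trans ?_
      have : 0 ≤ (26 + 5 * (d : ℝ) + 59 * cfg.passes) * P.nEgos ^ 4 := by positivity
      calc _ = 2 * ((26 + 5 * (d : ℝ) + 59 * cfg.passes) * P.nEgos ^ 4) := by ring
        _ ≤ 8 * ((26 + 5 * (d : ℝ) + 59 * cfg.passes) * P.nEgos ^ 4) := by linarith
        _ = _ := by ring

theorem exists_feature_and_ego_bounds (cfg : Settings) :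
    ∃ C : ℝ, 0 < C ∧ ∀ P : LinkTask,
      (∀ (s : Slicing) (δ : ℝ), 1 ≤ δ → P.SizeLE cfg s δ →
        (P.Undersampled → P.featureSteps cfg s ≤ C * (P.nLinks * δ)) ∧
        (P.FullDataset → P.featureSteps cfg s ≤ C * (P.nEgos ^ 2 * δ))) ∧
      P.egoSteps cfg .all = 0 ∧
      (∀ (x : ℕ) (Δ : ℝ), 2 ≤ Δ → P.SizeLE cfg .all Δ →
        P.egoSteps cfg (.circle x) ≤ C * (P.nEgos * (Δ * Real.log Δ))) := by
  refine ⟨8 * (41 + 23 * cfg.shiftIters), by positivity, fun P =>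
    ⟨fun s δ hδ hs => ⟨fun hU => ?_, fun _ => ?_⟩, P.egoSteps_all cfg,
      fun x Δ hΔ h => P.egoSteps_circle_le cfg x hΔ h⟩⟩
  · have h := P.featureSteps_le cfg s hδ hs
    rw [hU.card_trainLinks] at h
    push_cast at h
    have h0 : 0 ≤ P.nLinks * δ := mul_nonneg P.nLinks_nonneg (by linarith)
    have h1 : 0 ≤ (cfg.shiftIters : ℝ) * (P.nLinks * δ) := by positivity
    rw [nLinks] at *
    nlinarith
  · have h := P.featureSteps_le cfg s hδ hs
    have hcard : (P.trainLinks.card : ℝ) ≤ P.nEgos ^ 2 := by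
      rw [nEgos]; exact_mod_cast P.card_trainLinks_le
    refine h.trans (mul_le_mul ?_ (by gcongr) (by positivity) (by positivity))
    have : (0 : ℝ) ≤ cfg.shiftIters := Nat.cast_nonneg _
    linarith

/-- Everything before training is linear in `|E_e|`. The factor `90` is `45` per training link, with
two training links per positive. -/
theorem exists_ego_add_feature_le (cfg : Settings) (Δ B : ℝ) : ∃ K : ℝ, 0 < K ∧
    ∀ P : LinkTask, P.Undersampled → P.SizeLE cfg .all Δ → P.nEgos ≤ B * P.nLinks →
      ∀ s : Slicing, P.egoSteps cfg s + P.featureSteps cfg s ≤ K * P.nLinks := by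
  obtain ⟨C, hC, hego⟩ := exists_egoSteps_le cfg Δ
  refine ⟨C * |B| + 90 * max Δ 1, by positivity, fun P hU hΔ hB s => ?_⟩
  have h1 := hego P hΔ s
  have h2 := P.featureSteps_le cfg s (le_max_right Δ 1) ((hΔ.mono (le_max_left _ _)).sliced s)
  rw [hU.card_trainLinks] at h2
  push_cast at h2
  have h3 : P.nEgos ≤ |B| * P.nLinks :=
    hB.trans (mul_le_mul_of_nonneg_right (le_abs_self B) P.nLinks_nonneg)
  have h4 := mul_le_mul_of_nonneg_left h3 hC.le
  rw [nLinks] at *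
  linarith

theorem exists_training_dominates (cfg : Settings) (Δ B ε : ℝ) (hε : 0 < ε) :
    ∃ N : ℝ, ∀ P : LinkTask, P.Undersampled →
      P.SizeLE cfg .all Δ → P.nEgos ≤ B * P.nLinks → N ≤ P.nLinks →
      ∀ (s : Slicing) (L : Learner P.Link 4), ¬ L.IsLogisticOrBayes →
        P.egoSteps cfg s + P.featureSteps cfg s ≤ ε * P.trainSteps cfg s L ∧
        P.egoSteps cfg s ≤ ε * P.totalSteps cfg s L := by
  obtain ⟨K, hK, h⟩ := exists_ego_add_feature_le cfg Δ B
  -- Beyond this threshold `ε * log |E_e| ≥ K`, so `ε` times the training time exceeds the linear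
  -- bound `K * |E_e|`.
  refine ⟨Real.exp (K / ε), fun P hU hΔ hB hN s L hL => ?_⟩
  have h1 := h P hU hΔ hB s
  have h2 : P.nLinks * Real.log P.nLinks ≤ P.trainSteps cfg s L :=
    hU.le_trainStepsOn cfg (by norm_num) L _ hL
  have h3 : K / ε ≤ Real.log P.nLinks := by
    rw [← Real.log_exp (K / ε)]
    exact Real.log_le_log (Real.exp_pos _) hN
  rw [div_le_iff₀ hε] at h3
  have h4 := mul_le_mul_of_nonneg_left h3 P.nLinks_nonneg
  have h5 := mul_le_mul_of_nonneg_left h2 hε.le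
  have h6 := P.featureSteps_nonneg cfg s
  have h7 := P.egoSteps_nonneg cfg s
  have h8 : P.egoSteps cfg s + P.featureSteps cfg s ≤ ε * P.trainSteps cfg s L := by linarith
  refine ⟨h8, ?_⟩
  rw [totalSteps_eq]
  have h9 := mul_nonneg hε.le (add_nonneg h7 h6)
  linarith

theorem exists_total_le (cfg : Settings) (Δ B : ℝ) :
    ∃ C : ℝ, 0 < C ∧ ∀ P : LinkTask, P.Undersampled →
      P.SizeLE cfg .all Δ → P.nEgos ≤ B * P.nLinks → 1 ≤ P.nLinks →
      ∀ (s : Slicing) (L : Learner P.Link 4), L.IsLogisticOrBayes →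
        P.totalSteps cfg s L ≤ C * P.nLinks := by
  obtain ⟨K, hK, h⟩ := exists_ego_add_feature_le cfg Δ B
  refine ⟨K + 8 * (42 + 29 * cfg.epochs), by positivity, fun P hU hΔ hB hE s L hL => ?_⟩
  have h1 := h P hU hΔ hB s
  have h2 : P.trainSteps cfg s L ≤ _ := hU.trainStepsOn_le cfg (by norm_num) hE L hL _
  rw [totalSteps_eq]
  push_cast at h2
  linarith

theorem exists_baseline_lt_circle_le (cfg : Settings) (A B : ℝ) :
    ∃ C : ℝ, 0 < C ∧ ∃ Γ₀ : ℝ, ∀ Γ : ℝ, Γ₀ ≤ Γ → ∀ P : LinkTask, P.Undersampled →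
      (∀ i ∈ P.egos, Γ ≤ ((P.nbhd i).card : ℝ)) → P.SizeLE cfg .all (A * Γ) →
      P.nEgos ≤ B * P.nLinks → P.nLinks ≤ B * P.nEgos → 1 ≤ P.nLinks →
      ∀ (x : ℕ) (L : Learner P.Link 4), L.IsLogisticOrBayes →
        P.totalSteps cfg .all L < P.totalSteps cfg (.circle x) L ∧
        P.totalSteps cfg (.circle x) L ≤ C * Real.log Γ * P.totalSteps cfg .all L := by
  set K : ℝ := 8 * (41 + 23 * cfg.shiftIters) with hK
  have hKpos : 0 < K := by positivity
  -- The constants precede the network, when the signs of `A` and `B` are unknown; hence the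
  -- absolute values. The threshold ensures `log Γ - 1 > 90 * A * B`, and the final `+ 1` in the
  -- constant pays for features and training.
  refine ⟨K * |B| * |A| * (|A| + 1) + 1, by positivity, Real.exp (90 * |A| * |B| + 2),
    fun Γ hΓ P hU hlow hup hVE hEV hE x L hL => ?_⟩
  have hlog : 90 * |A| * |B| + 2 ≤ Real.log Γ := by
    rw [← Real.log_exp (90 * |A| * |B| + 2)]
    exact Real.log_le_log (Real.exp_pos _) hΓ
  have hΓ2 : 2 ≤ Γ := by
    have h1 := Real.add_one_le_exp (90 * |A| * |B| + 2)
    have h2 : 0 ≤ 90 * |A| * |B| := by positivity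
    linarith
  have hlog1 : 1 ≤ Real.log Γ := by
    have h2 : 0 ≤ 90 * |A| * |B| := by positivity
    linarith
  have hv : 0 < P.nEgos := by
    refine lt_of_le_of_ne P.nEgos_nonneg fun h0 => ?_
    rw [← h0, mul_zero] at hEV
    linarith
  have hB : 0 < B := pos_of_mul_pos_left (by linarith) hv.le
  -- There is an ego, and its degree lies between `Γ` and `A * Γ`.
  have hA : 1 ≤ A := by
    obtain ⟨i, hi⟩ : P.egos.Nonempty := Finset.card_pos.1 (Nat.cast_pos.1 hv)
    have h : Γ ≤ A * Γ := (hlow i hi).trans (hup i hi)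
    exact le_of_mul_le_mul_right (by linarith) (show 0 < Γ by linarith)
  rw [abs_of_pos hB, abs_of_pos (by linarith : 0 < A)] at *
  have hAΓ : Γ ≤ A * Γ := le_mul_of_one_le_left (by linarith) hA
  have htrain : P.trainSteps cfg (.circle x) L = P.trainSteps cfg .all L :=
    P.trainStepsOn_congr cfg L hL _ _
  have htrain0 := P.trainSteps_nonneg cfg .all L
  have hf0 := P.featureSteps_nonneg cfg (.circle x)
  have hfle := P.featureSteps_circle_le cfg x
  have hfa := P.featureSteps_le cfg .all (by linarith) hup
  have hcard : (P.trainLinks.card : ℝ) = 2 * P.nLinks := by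
    rw [hU.card_trainLinks, nLinks]; push_cast; rfl
  have hego := P.le_egoSteps_circle cfg x (by linarith) hlog1 hlow
  rw [totalSteps_eq, totalSteps_eq, egoSteps_all, htrain, zero_add]
  constructor
  -- Baseline features cost at most `90 * |E_e| * A * Γ ≤ 90 * A * B * |V_e| * Γ`, which is less
  -- than the sorting cost `|V_e| * Γ * (log Γ - 1)`.
  · have h1 : P.nLinks * (A * Γ) ≤ B * P.nEgos * (A * Γ) :=
      mul_le_mul_of_nonneg_right hEV (by linarith)
    have h2 : P.nEgos * Γ * (90 * A * B + 2) ≤ P.nEgos * Γ * Real.log Γ :=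
      mul_le_mul_of_nonneg_left hlog (by positivity)
    have h3 : 0 < P.nEgos * Γ := by positivity
    rw [hcard] at hfa
    nlinarith
  · have h1 := P.egoSteps_circle_le cfg x (by linarith) hup
    have h2 := P.card_mul_le_featureSteps_all cfg hlow
    -- From `log A ≤ A - 1` and `1 ≤ log Γ`.
    have hlogA : Real.log (A * Γ) ≤ (A + 1) * Real.log Γ := by
      rw [Real.log_mul (by linarith) (by linarith)]
      have := Real.log_le_sub_one_of_pos (show 0 < A by linarith)
      nlinarith
    rw [hcard] at h2
    have hEΓ : P.nLinks * Γ ≤ P.featureSteps cfg .all := by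
      have : 0 ≤ P.nLinks * Γ := mul_nonneg P.nLinks_nonneg (by linarith)
      linarith
    set T := P.featureSteps cfg .all + P.trainSteps cfg .all L with hT
    have h3 : P.egoSteps cfg (.circle x) ≤ K * B * A * (A + 1) * Real.log Γ * T := by
      calc _ ≤ K * (P.nEgos * (A * Γ * Real.log (A * Γ))) := h1
        _ ≤ K * ((B * P.nLinks) * (A * Γ * ((A + 1) * Real.log Γ))) := by
          have : 0 ≤ Real.log (A * Γ) := Real.log_nonneg (by linarith)
          have := P.nLinks_nonneg
          gcongr
        _ = K * B * A * (A + 1) * Real.log Γ * (P.nLinks * Γ) := by ring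
        _ ≤ _ := by gcongr; linarith
    have h4 : T ≤ Real.log Γ * T := le_mul_of_one_le_left (by linarith) hlog1
    linarith

theorem exists_full_ego_le (cfg : Settings) (Δ : ℝ) :
    ∃ C : ℝ, 0 < C ∧ ∀ P : LinkTask, P.FullDataset → P.SizeLE cfg .all Δ → ∀ x : ℕ,
      P.egoSteps cfg (.circle x) ≤ C * P.nEgos ∧
      P.nLinks ≤ C * P.nEgos ∧
      (∀ B : ℝ, P.nEgos ≤ B * P.nLinks →
        P.egoSteps cfg (.circle x) ≤ C * B * P.nLinks) := by
  obtain ⟨C, hC, hego⟩ := exists_egoSteps_le cfg Δ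
  have hmono : ∀ P : LinkTask, C * P.nEgos ≤ (C + |Δ|) * P.nEgos := fun P =>
    mul_le_mul_of_nonneg_right (by linarith [abs_nonneg Δ]) P.nEgos_nonneg
  refine ⟨C + |Δ|, by positivity, fun P _ hΔ x =>
    ⟨(hego P hΔ _).trans (hmono P), ?_, fun B hB => ?_⟩⟩
  · exact (P.nLinks_le hΔ).trans (mul_le_mul_of_nonneg_right
      (by linarith [le_abs_self Δ]) P.nEgos_nonneg)
  · rw [mul_assoc]
    exact ((hego P hΔ _).trans (hmono P)).trans
      (mul_le_mul_of_nonneg_left hB (by positivity))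

theorem exists_full_ego_negligible (cfg : Settings) (Δ ε : ℝ) (hε : 0 < ε) :
    ∃ N : ℝ, ∀ P : LinkTask, P.FullDataset → P.SizeLE cfg .all Δ →
      N ≤ P.nEgos → ∀ x : ℕ,
        (∀ L : Learner P.Link 4,
          P.egoSteps cfg (.circle x) ≤ ε * P.featureSteps cfg (.circle x) ∧
          P.egoSteps cfg (.circle x) ≤ ε * P.totalSteps cfg (.circle x) L) ∧
        ((∀ i ∈ P.egos, (P.sliced cfg (.circle x) i).card < (P.nbhd i).card) →
          P.egoSteps cfg (.circle x) + P.featureSteps cfg (.circle x) <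
            P.featureSteps cfg .all) := by
  obtain ⟨C, hC, hego⟩ := exists_egoSteps_le cfg Δ
  -- Makes `|V_e| - 1` at least `3 * C + 3 * C / ε`, so the number of training links, at least `9/20
  -- * |V_e| * (|V_e| - 1)`, exceeds both `C * |V_e|` (for the strict saving) and `|V_e| * C / ε`
  -- (for negligibility).
  refine ⟨2 + 3 * C + 3 * (C / ε), fun P hF hΔ hN x => ?_⟩
  have h1 := hego P hΔ (.circle x)
  have h2 := hF.le_card_trainLinks
  have hCε : 0 < C / ε := by positivity
  have hv : 0 < P.nEgos := by linarith
  have h3 : P.nEgos * (3 * C + 3 * (C / ε)) ≤ P.nEgos * (P.nEgos - 1) :=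
    mul_le_mul_of_nonneg_left (by linarith) hv.le
  have h4 : 0 < P.nEgos * C := by positivity
  have h5 : 0 < P.nEgos * (C / ε) := by positivity
  have h6 : C * P.nEgos < P.trainLinks.card := by nlinarith
  have h7 : P.nEgos * (C / ε) ≤ P.trainLinks.card := by nlinarith
  have h8 : P.egoSteps cfg (.circle x) ≤ ε * P.featureSteps cfg (.circle x) := by
    have h9 := mul_le_mul_of_nonneg_left (h7.trans (P.le_featureSteps cfg (.circle x))) hε.le
    have h10 : ε * (P.nEgos * (C / ε)) = C * P.nEgos := by field_simp
    linarith
  refine ⟨fun L => ⟨h8, h8.trans (mul_le_mul_of_nonneg_left ?_ hε.le)⟩, fun h => ?_⟩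
  · rw [totalSteps_eq]
    linarith [P.egoSteps_nonneg cfg (.circle x), P.trainSteps_nonneg cfg (.circle x) L]
  · linarith [P.featureSteps_circle_add_le cfg x h]

end LinkTask

theorem mainTheorem2 (cfg : Settings) :
    -- the phases add up, and the extracted features are the heuristics
    (∀ (P : LinkTask) (s : Slicing),
      (∀ L : Learner P.Link 4,
        P.totalSteps cfg s L = P.egoSteps cfg s + P.featureSteps cfg s + P.trainSteps cfg s L) ∧
      (∀ (p : P.Link) (f : Fin 4), (P.featurePhase (P.sliced cfg s)).val p f =
        P.similarity (heuristics f) (P.sliced cfg s) p.1.1 p.1.2)) ∧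
    -- the table, training
    (∃ C : ℝ, 0 < C ∧ ∃ C' : ℕ → ℝ, (∀ d, 0 < C' d) ∧
      ∀ (P : LinkTask) (d : ℕ), 1 ≤ d → ∀ X : P.Link → Fin d → ℝ,
        (P.Undersampled → 2 ≤ P.nLinks →
          P.trainStepsOn cfg .logistic X ≤ C * (P.nLinks * d) ∧
          P.trainStepsOn cfg .naiveBayes X ≤ C * (P.nLinks * d) ∧
          P.trainStepsOn cfg .decisionTree X ≤ C * (P.nLinks * Real.log P.nLinks * d) ∧
          (∀ k hk boot cand, P.trainStepsOn cfg (.randomForest k hk boot cand) X ≤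
            C * (P.nLinks * Real.log P.nLinks * d * k)) ∧
          P.trainStepsOn cfg .svm X ≤ C' d * P.nLinks ^ 2) ∧
        (P.FullDataset → 2 ≤ P.nEgos →
          P.trainStepsOn cfg .logistic X ≤ C * (P.nEgos ^ 2 * d) ∧
          P.trainStepsOn cfg .naiveBayes X ≤ C * (P.nEgos ^ 2 * d) ∧
          P.trainStepsOn cfg .decisionTree X ≤ C * (P.nEgos ^ 2 * Real.log (P.nEgos ^ 2) * d) ∧
          (∀ k hk boot cand, P.trainStepsOn cfg (.randomForest k hk boot cand) X ≤
            C * (P.nEgos ^ 2 * Real.log (P.nEgos ^ 2) * d * k)) ∧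
          P.trainStepsOn cfg .svm X ≤ C' d * P.nEgos ^ 4)) ∧
    -- the table, feature extraction (baseline and circle-aware) and ego networks
    (∃ C : ℝ, 0 < C ∧ ∀ P : LinkTask,
      (∀ (s : Slicing) (δ : ℝ), 1 ≤ δ → P.SizeLE cfg s δ →
        (P.Undersampled → P.featureSteps cfg s ≤ C * (P.nLinks * δ)) ∧
        (P.FullDataset → P.featureSteps cfg s ≤ C * (P.nEgos ^ 2 * δ))) ∧
      P.egoSteps cfg .all = 0 ∧
      (∀ (x : ℕ) (Δ : ℝ), 2 ≤ Δ → P.SizeLE cfg .all Δ →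
        P.egoSteps cfg (.circle x) ≤ C * (P.nEgos * (Δ * Real.log Δ)))) ∧
    -- undersampled negatives, decision trees, random forest, SVM
    (∃ c : ℝ, 0 < c ∧ ∀ P : LinkTask, P.Undersampled →
      ∀ d : ℕ, 1 ≤ d → ∀ (L : Learner P.Link d) (X : P.Link → Fin d → ℝ),
        ¬ L.IsLogisticOrBayes →
        c * (P.nLinks * Real.log P.nLinks) ≤ P.trainStepsOn cfg L X) ∧
    (∀ Δ B ε : ℝ, 0 < ε → ∃ N : ℝ, ∀ P : LinkTask, P.Undersampled →
      P.SizeLE cfg .all Δ → P.nEgos ≤ B * P.nLinks → N ≤ P.nLinks →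
      ∀ (s : Slicing) (L : Learner P.Link 4), ¬ L.IsLogisticOrBayes →
        P.egoSteps cfg s + P.featureSteps cfg s ≤ ε * P.trainSteps cfg s L ∧
        P.egoSteps cfg s ≤ ε * P.totalSteps cfg s L) ∧
    -- undersampled negatives, logistic regression and naive Bayes
    (∀ Δ B : ℝ, ∃ C : ℝ, 0 < C ∧ ∀ P : LinkTask, P.Undersampled →
      P.SizeLE cfg .all Δ → P.nEgos ≤ B * P.nLinks → 1 ≤ P.nLinks →
      ∀ (s : Slicing) (L : Learner P.Link 4), L.IsLogisticOrBayes →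
        P.totalSteps cfg s L ≤ C * P.nLinks) ∧
    (∀ A B : ℝ, ∃ C : ℝ, 0 < C ∧ ∃ Γ₀ : ℝ, ∀ Γ : ℝ, Γ₀ ≤ Γ → ∀ P : LinkTask, P.Undersampled →
      (∀ i ∈ P.egos, Γ ≤ ((P.nbhd i).card : ℝ)) → P.SizeLE cfg .all (A * Γ) →
      P.nEgos ≤ B * P.nLinks → P.nLinks ≤ B * P.nEgos → 1 ≤ P.nLinks →
      ∀ (x : ℕ) (L : Learner P.Link 4), L.IsLogisticOrBayes →
        P.totalSteps cfg .all L < P.totalSteps cfg (.circle x) L ∧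
        P.totalSteps cfg (.circle x) L ≤ C * Real.log Γ * P.totalSteps cfg .all L) ∧
    -- negatives that are not undersampled
    (∀ P : LinkTask, ∀ x : ℕ, P.featureSteps cfg (.circle x) ≤ P.featureSteps cfg .all) ∧
    (∀ Δ : ℝ, ∃ C : ℝ, 0 < C ∧ ∀ P : LinkTask, P.FullDataset → P.SizeLE cfg .all Δ → ∀ x : ℕ,
      P.egoSteps cfg (.circle x) ≤ C * P.nEgos ∧
      P.nLinks ≤ C * P.nEgos ∧
      (∀ B : ℝ, P.nEgos ≤ B * P.nLinks → P.egoSteps cfg (.circle x) ≤ C * B * P.nLinks)) ∧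
    (∀ Δ ε : ℝ, 0 < ε → ∃ N : ℝ, ∀ P : LinkTask, P.FullDataset → P.SizeLE cfg .all Δ →
      N ≤ P.nEgos → ∀ x : ℕ,
        (∀ L : Learner P.Link 4,
          P.egoSteps cfg (.circle x) ≤ ε * P.featureSteps cfg (.circle x) ∧
          P.egoSteps cfg (.circle x) ≤ ε * P.totalSteps cfg (.circle x) L) ∧
        ((∀ i ∈ P.egos, (P.sliced cfg (.circle x) i).card < (P.nbhd i).card) →
          P.egoSteps cfg (.circle x) + P.featureSteps cfg (.circle x) <
            P.featureSteps cfg .all)) := by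
  refine ⟨fun P s => ⟨P.totalSteps_eq cfg s, fun p f => P.heuristic_val _ _ _ _⟩,
    LinkTask.exists_training_bounds cfg, LinkTask.exists_feature_and_ego_bounds cfg,
    ⟨1, one_pos, fun P hU d hd L X hL => ?_⟩, LinkTask.exists_training_dominates cfg,
    LinkTask.exists_total_le cfg, LinkTask.exists_baseline_lt_circle_le cfg,
    fun P x => P.featureSteps_circle_le cfg x, LinkTask.exists_full_ego_le cfg,
    LinkTask.exists_full_ego_negligible cfg⟩
  rw [one_mul]
  exact hU.le_trainStepsOn cfg hd L X hL
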